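/- There is a polynomial-time algorithm that decides, given $m,n\in\mathbb N$, a prime $p$, $c\in(\mathbb Z\cup\{-\infty\})^n$, $\delta\in\{0,1\}^n$, $A\in\mathbb Q^{m\times n}$ and $b\in\mathbb Q^m$, whether there exists $x\in\mathbb Q^n$ with $Ax=b$ such that $v_p(x_j)\ge c_j$ for every $j\in\{1,\dots,n\}$ and, in the case $p=2$, also $v_2(x_j)=c_j$ for every $j$ with $\delta_j=1$ and $c_j\ne-\infty$. Here $v_p$ is the $p$-adic valuation on $\mathbb Q$, with $v_p(0)=\infty$. All integers in the input (in particular $p$ and the finite $c_j$) are written in binary, and rational numbers as reduced fractions of such integers. Running time is measured in bit operations (bit cost on a random access machine). Polynomial time means that it is bounded by a polynomial in the input size $$\max\{1,m,n\}+\sum_{i,j}h(a_{ij})+\sum_i h(b_i)+h(p)+\sum_j h(c_j)+\sum_j h(\delta_j),$$ where $h(\pm\frac rs)=1+\lfloor\log_2 r\rfloor+\lfloor\log_2 s\rfloor$ for coprime integers $r,s\ge1$, and $h(0)=h(-\infty)=1$. -/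

import Mathlib

/-!
# Random access machines with bit cost

The machine model is the usual random access machine over the integers: integer registers, integer
arrays (the memory) with computed addresses, and structured control flow.  Time is the bit cost:
each instruction is charged according to the binary lengths of all the numbers (operands,
addresses, contents) that it handles, so that polynomial time for this cost is the same as
polynomial time on a multitape Turing machine.  A program mentions only finitely many registers
and arrays, and one and the same program has to treat inputs of all sizes.
-/

namespace BitRAM

/-- The arithmetic operations of the machine. -/
inductive Op where
  | add
  | sub
  | mul
  | div
  | mod

/-- Values of the operations; `div` and `mod` are quotient and remainder of integer division
(with `x / 0 = 0` and `x % 0 = x`). -/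
def Op.eval : Op → ℤ → ℤ → ℤ
  | .add, x, y => x + y
  | .sub, x, y => x - y
  | .mul, x, y => x * y
  | .div, x, y => x / y
  | .mod, x, y => x % y

/-- A memory state: the contents of the registers, and `mem a k` the content of cell `k` of
array `a`. -/
structure State where
  reg : ℕ → ℤ
  mem : ℕ → ℕ → ℤ

/-- `s.setReg i z` is `s` with `z` written to register `i`. -/
def State.setReg (s : State) (i : ℕ) (z : ℤ) : State :=
  { s with reg := Function.update s.reg i z }

/-- `s.setMem a k z` is `s` with `z` written to cell `k` of array `a`. -/
def State.setMem (s : State) (a k : ℕ) (z : ℤ) : State :=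
  { s with mem := Function.update s.mem a (Function.update (s.mem a) k z) }

/-- Programs. -/
inductive Prog where
  /-- do nothing -/
  | skip
  /-- register `i` := the constant `z` -/
  | const (i : ℕ) (z : ℤ)
  /-- register `i` := (register `j`) `o` (register `k`) -/
  | arith (o : Op) (i j k : ℕ)
  /-- register `i` := cell of array `a` whose address is in register `j` -/
  | load (i a j : ℕ)
  /-- cell of array `a` whose address is in register `i` := register `j` -/
  | store (a i j : ℕ)
  /-- first `P`, then `Q` -/
  | seq (P Q : Prog)
  /-- if register `i` is positive then `P` else `Q` -/
  | cond (i : ℕ) (P Q : Prog)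
  /-- while register `i` is positive do `P` -/
  | loop (i : ℕ) (P : Prog)

/-- Binary length of an integer, with one bit for the sign. -/
def bits (z : ℤ) : ℕ := 1 + Nat.size z.natAbs

/-- `Exec P s t s'`: started in state `s`, the program `P` halts after time `t` (total bit cost of
the executed instructions and tests) in state `s'`.  An arithmetic operation on numbers of total
length `l` is charged `l ^ 2`, which covers the bit operations of the schoolbook methods. -/
inductive Exec : Prog → State → ℕ → State → Prop
  | skip (s : State) : Exec .skip s 1 s
  | const (s : State) (i : ℕ) (z : ℤ) : Exec (.const i z) s (bits z) (s.setReg i z)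
  | arith (s : State) (o : Op) (i j k : ℕ) :
      Exec (.arith o i j k) s ((bits (s.reg j) + bits (s.reg k)) ^ 2)
        (s.setReg i (o.eval (s.reg j) (s.reg k)))
  | load (s : State) (i a j : ℕ) :
      Exec (.load i a j) s (bits (s.reg j) + bits (s.mem a (s.reg j).toNat))
        (s.setReg i (s.mem a (s.reg j).toNat))
  | store (s : State) (a i j : ℕ) :
      Exec (.store a i j) s (bits (s.reg i) + bits (s.reg j))
        (s.setMem a (s.reg i).toNat (s.reg j))
  | seq {P Q : Prog} {s s' s'' : State} {t t' : ℕ} (hP : Exec P s t s') (hQ : Exec Q s' t' s'') :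
      Exec (.seq P Q) s (t + t') s''
  | condTrue {i : ℕ} {P Q : Prog} {s s' : State} {t : ℕ} (hi : 0 < s.reg i) (hP : Exec P s t s') :
      Exec (.cond i P Q) s (bits (s.reg i) + t) s'
  | condFalse {i : ℕ} {P Q : Prog} {s s' : State} {t : ℕ} (hi : s.reg i ≤ 0) (hQ : Exec Q s t s') :
      Exec (.cond i P Q) s (bits (s.reg i) + t) s'
  | loopTrue {i : ℕ} {P : Prog} {s s' s'' : State} {t t' : ℕ} (hi : 0 < s.reg i)
      (hP : Exec P s t s') (hL : Exec (.loop i P) s' t' s'') :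
      Exec (.loop i P) s (bits (s.reg i) + t + t') s''
  | loopFalse {i : ℕ} {P : Prog} {s : State} (hi : s.reg i ≤ 0) :
      Exec (.loop i P) s (bits (s.reg i)) s

/-- The machine is deterministic: running time and result are functions of program and start. -/
theorem Exec.deterministic {P : Prog} {s s₁ s₂ : State} {t₁ t₂ : ℕ}
    (h₁ : Exec P s t₁ s₁) (h₂ : Exec P s t₂ s₂) : t₁ = t₂ ∧ s₁ = s₂ := by
  induction h₁ generalizing t₂ s₂ with
  | skip s => cases h₂; exact ⟨rfl, rfl⟩
  | const s i z => cases h₂; exact ⟨rfl, rfl⟩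
  | arith s o i j k => cases h₂; exact ⟨rfl, rfl⟩
  | load s i a j => cases h₂; exact ⟨rfl, rfl⟩
  | store s a i j => cases h₂; exact ⟨rfl, rfl⟩
  | seq _ _ ihP ihQ =>
    cases h₂ with
    | seq hP hQ =>
      obtain ⟨rfl, rfl⟩ := ihP hP
      obtain ⟨rfl, rfl⟩ := ihQ hQ
      exact ⟨rfl, rfl⟩
  | condTrue hi _ ih =>
    cases h₂ with
    | condTrue _ hP => obtain ⟨rfl, rfl⟩ := ih hP; exact ⟨rfl, rfl⟩
    | condFalse hi' _ => exact absurd hi (not_lt.mpr hi')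
  | condFalse hi _ ih =>
    cases h₂ with
    | condTrue hi' _ => exact absurd hi' (not_lt.mpr hi)
    | condFalse _ hQ => obtain ⟨rfl, rfl⟩ := ih hQ; exact ⟨rfl, rfl⟩
  | loopTrue hi _ _ ihP ihL =>
    cases h₂ with
    | loopTrue _ hP hL =>
      obtain ⟨rfl, rfl⟩ := ihP hP
      obtain ⟨rfl, rfl⟩ := ihL hL
      exact ⟨rfl, rfl⟩
    | loopFalse hi' => exact absurd hi (not_lt.mpr hi')
  | loopFalse hi =>
    cases h₂ with
    | loopTrue hi' _ _ => exact absurd hi' (not_lt.mpr hi)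
    | loopFalse _ => exact ⟨rfl, rfl⟩

/-- The initial state on an input word of integers: the input is in the first cells of array `0`,
everything else is `0`. -/
def init (w : List ℤ) : State where
  reg := fun _ => 0
  mem := fun a k => if a = 0 then w.getD k 0 else 0

/-- The decision problem `Q`, on inputs that are written as words of integers by `encode` and whose
size is measured by `size`, is decided by a program in time polynomial in the input size.  The
program halts on every input, with `1` (yes) or `0` (no) in register `0`. -/
def DecidableInPolyTime {α : Type} (encode : α → List ℤ) (size : α → ℕ) (Q : α → Prop) : Prop :=
  ∃ (P : Prog) (T : Polynomial ℕ), ∀ a : α, ∃ (t : ℕ) (s : State),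
    Exec P (init (encode a)) t s ∧ t ≤ T.eval (size a) ∧
      ((Q a ∧ s.reg 0 = 1) ∨ (¬ Q a ∧ s.reg 0 = 0))

end BitRAM

/-! ### Linear systems with lower valuation bounds -/

/-- The `p`-adic valuation on `ℚ`, with `v_p(0) = ∞`. -/
def ratVal (p : ℕ) (x : ℚ) : WithTop ℤ :=
  if x = 0 then ⊤ else (padicValRat p x : WithTop ℤ)

/-- Input of the problem; `⊥ : WithBot ℤ` is `-∞`. -/
structure ValuedSystem where
  m : ℕ
  n : ℕ
  p : ℕ
  prime : p.Prime
  c : Fin n → WithBot ℤ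
  δ : Fin n → Bool
  A : Matrix (Fin m) (Fin n) ℚ
  b : Fin m → ℚ

namespace ValuedSystem

/-- `A x = b` has a rational solution with `v_p(x_j) ≥ c_j` for all `j` and, in the case `p = 2`,
`v_p(x_j) = c_j` for all `j` with `δ_j = 1` and `c_j ≠ -∞`. -/
def Solvable (S : ValuedSystem) : Prop :=
  ∃ x : Fin S.n → ℚ,
    S.A.mulVec x = S.b ∧
    (∀ (j : Fin S.n) (k : ℤ), S.c j = (k : WithBot ℤ) → (k : WithTop ℤ) ≤ ratVal S.p (x j)) ∧
    (S.p = 2 → ∀ (j : Fin S.n) (k : ℤ), S.δ j = true → S.c j = (k : WithBot ℤ) →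
      ratVal S.p (x j) = (k : WithTop ℤ))

/-- A rational number is written as reduced numerator and denominator. -/
def encodeRat (q : ℚ) : List ℤ := [q.num, (q.den : ℤ)]

/-- `-∞` is written as `0, 0` and an integer `k` as `1, k`. -/
def encodeBound : WithBot ℤ → List ℤ
  | none => [0, 0]
  | some k => [1, k]

/-- The input word: `m, n, p`, then `c`, `δ`, the entries of `A` row by row, and `b`. -/
def encode (S : ValuedSystem) : List ℤ :=
  [(S.m : ℤ), (S.n : ℤ), (S.p : ℤ)]
    ++ (List.ofFn fun j => encodeBound (S.c j)).flatten
    ++ (List.ofFn fun j => if S.δ j then (1 : ℤ) else 0)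
    ++ (List.ofFn fun i => (List.ofFn fun j => encodeRat (S.A i j)).flatten).flatten
    ++ (List.ofFn fun i => encodeRat (S.b i)).flatten

/-- Height of a rational number: `1 + log |a| + log |b|` for the reduced fraction `a / b ≠ 0`, and
`1` for `0`; the logarithms are to base two and rounded down. -/
def height (q : ℚ) : ℕ := 1 + Nat.log 2 q.num.natAbs + Nat.log 2 q.den

/-- Height of a bound; the height of `-∞` is `1`. -/
def heightBound : WithBot ℤ → ℕ
  | none => 1
  | some k => height (k : ℚ)

/-- Input size: the maximal number of rows or columns of one of the matrices
`A`, `b`, `p`, `c`, `δ`, plus the heights of all their entries. -/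
def size (S : ValuedSystem) : ℕ :=
  max 1 (max S.m S.n)
    + ∑ i, ∑ j, height (S.A i j)
    + ∑ i, height (S.b i)
    + height (S.p : ℚ)
    + ∑ j, heightBound (S.c j)
    + ∑ j, height (if S.δ j then 1 else 0)

end ValuedSystem

/-!
# A structured language on top of the random access machine

Expressions and commands are compiled to programs of the machine: variable `v` is kept in register
`2 * v`, and the odd registers hold intermediate results.  Running time is controlled by two
numbers: a bound `B` on the absolute values of all stored numbers and a bound `K` on the number of
iterations of every loop.
-/

namespace BitRAM

/-! Arithmetic. Let `∑ a j * x j = β` be one of the equations, and read `δ j` as `0` unless `p = 2`.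
If some `a q ≠ 0` has `c q = -∞`, then `x q` is unconstrained and can be eliminated freely.
Otherwise put `w j = v_p(a j) + c j + δ j` for the columns with `a j ≠ 0`. The constraint on `x j`
says that `a j * x j` lies in `p ^ w j * ℤ_(p)` or, if `δ j = 1`, in the coset of `2 ^ (w j - 1)`
modulo `2 ^ w j * ℤ_(2)`. That this is a single coset is special to `p = 2` (`valEq_two_iff`,
`admissible_iff_valGe`).

Choose `q` of minimal weight `g = w q`. Modulo `p ^ g` all other terms are known: each is `0`, or `2
^ (g - 1)` for a column with `δ j = 1` and `w j = g`. So, given the equation, the constraint on `x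
q` is a condition on `β` alone, which depends on the parity of the number of such columns
(`admissible_pivot_iff`). Hence `x q` and its constraint can be removed from the problem together
(`rowsSolvable_iff_of_pivot`), a row of zeros requires `β = 0` (`rowsSolvable_iff_of_zero`), and no
choice of a pivot is ever revised. The tests only compare valuations; the powers `p ^ c j`, which
may have exponentially many digits, are never computed.

Size. Denominators are cleared row by row, and the elimination is fraction-free. By Sylvester's
identity the divisions are exact and all entries remain minors of the integral matrix
(`det_mul_det_bordered_bordered`, `Bareiss.step`), so their bit lengths are quadratic in the input
size (`Bareiss.abs_entry_le`, `factorial_mul_pow_le`).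

Machine. The algorithm is a command of a small structured language. A weakest precondition `Cmd.wp`
combines correctness with a bound on stored numbers and on loop iterations; compilation turns such a
proof into a bound on the bit cost (`Cmd.runsIn_compile`, `decidableInPolyTime_of_wp`). -/

@[simp] theorem State.setReg_reg (s : State) (i j : ℕ) (z : ℤ) :
    (s.setReg i z).reg j = if j = i then z else s.reg j := by
  simp [State.setReg, Function.update_apply]

@[simp] theorem State.setReg_mem (s : State) (i : ℕ) (z : ℤ) : (s.setReg i z).mem = s.mem := rfl

@[simp] theorem State.setMem_reg (s : State) (a k : ℕ) (z : ℤ) :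
    (s.setMem a k z).reg = s.reg := rfl

theorem State.setMem_mem (s : State) (a k b l : ℕ) (z : ℤ) :
    (s.setMem a k z).mem b l = if b = a ∧ l = k then z else s.mem b l := by
  by_cases h : b = a
  · subst h; simp [State.setMem, Function.update_apply]
  · simp [State.setMem, h]

@[simp] theorem State.setMem_mem_self (s : State) (a k l : ℕ) (z : ℤ) :
    (s.setMem a k z).mem a l = if l = k then z else s.mem a l := by
  simp [State.setMem_mem]

@[simp] theorem State.setMem_mem_of_ne (s : State) {a b : ℕ} (h : b ≠ a) (k : ℕ) (z : ℤ) :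
    (s.setMem a k z).mem b = s.mem b := by
  funext l; simp [State.setMem_mem, h]

/-- All numbers in the memory state have absolute value at most `B`. -/
structure State.Le (s : State) (B : ℤ) : Prop where
  reg : ∀ v, |s.reg v| ≤ B
  mem : ∀ a k, |s.mem a k| ≤ B

theorem State.Le.setReg {s : State} {B : ℤ} (h : s.Le B) (i : ℕ) {z : ℤ} (hz : |z| ≤ B) :
    (s.setReg i z).Le B := by
  refine ⟨fun v => ?_, h.mem⟩
  rw [State.setReg_reg]
  split_ifs
  exacts [hz, h.reg v]

theorem State.Le.setMem {s : State} {B : ℤ} (h : s.Le B) (a k : ℕ) {z : ℤ} (hz : |z| ≤ B) :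
    (s.setMem a k z).Le B := by
  refine ⟨h.reg, fun b l => ?_⟩
  rw [State.setMem_mem]
  split_ifs
  exacts [hz, h.mem b l]

/-- Arithmetic expressions over variables and array cells. -/
inductive Expr where
  | var (v : ℕ)
  | const (z : ℤ)
  | op (o : Op) (e f : Expr)
  | read (a : ℕ) (e : Expr)

namespace Expr

instance : Add Expr := ⟨.op .add⟩
instance : Sub Expr := ⟨.op .sub⟩
instance : Mul Expr := ⟨.op .mul⟩
instance : Div Expr := ⟨.op .div⟩
instance : Mod Expr := ⟨.op .mod⟩
instance (n : ℕ) : OfNat Expr n := ⟨.const n⟩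

/-- The value of an expression. -/
def eval (s : State) : Expr → ℤ
  | var v => s.reg v
  | const z => z
  | op o e f => o.eval (e.eval s) (f.eval s)
  | read a e => s.mem a (e.eval s).toNat

@[simp] theorem eval_var (s : State) (v : ℕ) : (var v).eval s = s.reg v := rfl
@[simp] theorem eval_read (s : State) (a : ℕ) (e : Expr) :
    (read a e).eval s = s.mem a (e.eval s).toNat := rfl
@[simp] theorem eval_add (s : State) (e f : Expr) : (e + f).eval s = e.eval s + f.eval s := rfl
@[simp] theorem eval_sub (s : State) (e f : Expr) : (e - f).eval s = e.eval s - f.eval s := rfl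
@[simp] theorem eval_mul (s : State) (e f : Expr) : (e * f).eval s = e.eval s * f.eval s := rfl
@[simp] theorem eval_div (s : State) (e f : Expr) : (e / f).eval s = e.eval s / f.eval s := rfl
@[simp] theorem eval_mod (s : State) (e f : Expr) : (e % f).eval s = e.eval s % f.eval s := rfl
@[simp] theorem eval_zero (s : State) : (0 : Expr).eval s = 0 := rfl
@[simp] theorem eval_one (s : State) : (1 : Expr).eval s = 1 := rfl
@[simp] theorem eval_ofNat (s : State) (n : ℕ) [n.AtLeastTwo] :
    (ofNat(n) : Expr).eval s = ofNat(n) := rfl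

/-- Evaluation of an expression into register `2 * k + 1`. -/
def compile : Expr → ℕ → Prog
  | var v, k => .seq (.const (2 * k + 1) 0) (.arith .add (2 * k + 1) (2 * v) (2 * k + 1))
  | const z, k => .const (2 * k + 1) z
  | op o e f, k => .seq (e.compile k)
      (.seq (f.compile (k + 1)) (.arith o (2 * k + 1) (2 * k + 1) (2 * (k + 1) + 1)))
  | read a e, k => .seq (e.compile k) (.load (2 * k + 1) a (2 * k + 1))

/-- Number of machine instructions for an expression. -/
def cost : Expr → ℕ
  | var _ => 2
  | const _ => 1
  | op _ e f => e.cost + f.cost + 1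
  | read _ e => e.cost + 1

/-- If all stored numbers are at most `B` in absolute value, then the value of an expression is at
most `B` to the power of its degree. -/
def degree : Expr → ℕ
  | var _ => 1
  | const z => z.natAbs
  | op _ e f => e.degree + f.degree + 1
  | read _ e => e.degree + 1

end Expr

/-- The factor `2` serves addition and subtraction, where `X + Y ≤ 2 * (X * Y)` as `X, Y ≥ 1`.
Quotients are bounded by `|x|`, remainders by `|y|`, or by `|x|` if `y = 0`. -/
theorem Op.abs_eval_le (o : Op) {x y X Y : ℤ} (hx : |x| ≤ X) (hy : |y| ≤ Y) (hX : 1 ≤ X)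
    (hY : 1 ≤ Y) : |o.eval x y| ≤ 2 * (X * Y) := by
  have h1 : X ≤ X * Y := by nlinarith
  have h2 : Y ≤ X * Y := by nlinarith
  have hx0 := abs_nonneg x
  cases o with
  | add => exact (abs_add_le x y).trans (by linarith)
  | sub => exact (abs_sub x y).trans (by linarith)
  | mul =>
    rw [Op.eval, abs_mul]
    have := mul_le_mul hx hy (abs_nonneg y) (by linarith)
    linarith
  | div =>
    rw [Op.eval]
    have : |x / y| ≤ |x| := by
      have := Int.natAbs_ediv_le_natAbs x y
      rw [Int.abs_eq_natAbs, Int.abs_eq_natAbs]; exact_mod_cast this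
    linarith
  | mod =>
    rw [Op.eval]
    by_cases h : y = 0
    · subst h; rw [Int.emod_zero]; linarith
    · rw [abs_of_nonneg (Int.emod_nonneg x h)]
      have := Int.emod_lt_abs x h
      linarith

/-- The degree is made for this induction: a constant `z` contributes `|z|` because `|z| ≤ 2 ^ |z|`,
and the summand `1` of an operation absorbs the factor `2` of `Op.abs_eval_le`. -/
theorem Expr.abs_eval_le {s : State} {B : ℤ} (hB : 2 ≤ B) (hs : s.Le B) (e : Expr) :
    |e.eval s| ≤ B ^ e.degree := by
  have hB1 : 1 ≤ B := by linarith
  induction e with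
  | var v => simpa [Expr.degree] using hs.reg v
  | const z =>
    simp only [Expr.eval, Expr.degree]
    calc |z| = ((z.natAbs : ℕ) : ℤ) := Int.abs_eq_natAbs z
      _ ≤ 2 ^ z.natAbs := by exact_mod_cast z.natAbs.lt_two_pow_self.le
      _ ≤ B ^ z.natAbs := pow_le_pow_left₀ (by norm_num) hB _
  | op o e f ihe ihf =>
    refine (o.abs_eval_le ihe ihf (one_le_pow₀ hB1) (one_le_pow₀ hB1)).trans ?_
    simp only [Expr.degree]
    rw [pow_succ, pow_add]
    have : (0 : ℤ) ≤ B ^ e.degree * B ^ f.degree := by positivity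
    nlinarith
  | read a e ih =>
    refine (hs.mem a _).trans ?_
    exact le_self_pow₀ hB1 (Nat.succ_ne_zero _)

/-- The machine state `s` represents the state `σ` of the structured language. -/
structure Represents (s σ : State) : Prop where
  reg : ∀ v, s.reg (2 * v) = σ.reg v
  mem : s.mem = σ.mem

theorem Represents.setReg_odd {s σ : State} (h : Represents s σ) (k : ℕ) (z : ℤ) :
    Represents (s.setReg (2 * k + 1) z) σ := by
  refine ⟨fun v => ?_, h.mem⟩
  rw [State.setReg_reg, if_neg (by omega), h.reg]

theorem Represents.setReg {s σ : State} (h : Represents s σ) (v : ℕ) (z : ℤ) :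
    Represents (s.setReg (2 * v) z) (σ.setReg v z) := by
  refine ⟨fun w => ?_, h.mem⟩
  rw [State.setReg_reg, State.setReg_reg, h.reg]
  congr 1
  simp

theorem Represents.setMem {s σ : State} (h : Represents s σ) (a k : ℕ) (z : ℤ) :
    Represents (s.setMem a k z) (σ.setMem a k z) := by
  refine ⟨h.reg, ?_⟩
  funext b l
  rw [State.setMem_mem, State.setMem_mem, h.mem]

/-- `RunsIn P s T s'`: the program `P` leads from `s` to `s'` in time at most `T`. -/
def RunsIn (P : Prog) (s : State) (T : ℕ) (s' : State) : Prop :=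
  ∃ t ≤ T, Exec P s t s'

theorem RunsIn.mono {P : Prog} {s s' : State} {T T' : ℕ} (h : RunsIn P s T s') (hT : T ≤ T') :
    RunsIn P s T' s' := by
  obtain ⟨t, ht, h⟩ := h
  exact ⟨t, ht.trans hT, h⟩

theorem RunsIn.seq {P Q : Prog} {s s' s'' : State} {T T' : ℕ} (h : RunsIn P s T s')
    (h' : RunsIn Q s' T' s'') : RunsIn (.seq P Q) s (T + T') s'' := by
  obtain ⟨t, ht, h⟩ := h
  obtain ⟨t', ht', h'⟩ := h'
  exact ⟨t + t', by omega, .seq h h'⟩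

/-! ### Time of single instructions and of expressions -/

section Instructions

variable {X : ℤ} {L : ℕ}

theorem one_le_bits (z : ℤ) : 1 ≤ bits z := by simp [bits]

theorem le_two_mul_sq (L : ℕ) : 2 * L ≤ (2 * L) ^ 2 := Nat.le_self_pow two_ne_zero _

/-- One budget `(2 * L) ^ 2` serves for every instruction: it is the charge for arithmetic on two
numbers of length `L`, and it dominates the linear charges of the others. -/
theorem runsIn_const (hL : ∀ z : ℤ, |z| ≤ X → bits z ≤ L) (s : State) (i : ℕ) {z : ℤ}
    (hz : |z| ≤ X) : RunsIn (.const i z) s ((2 * L) ^ 2) (s.setReg i z) :=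
  ⟨_, by have := hL z hz; have := le_two_mul_sq L; omega, .const s i z⟩

theorem runsIn_arith (hL : ∀ z : ℤ, |z| ≤ X → bits z ≤ L) (s : State) (o : Op) (i : ℕ) {j k : ℕ}
    (hj : |s.reg j| ≤ X) (hk : |s.reg k| ≤ X) :
    RunsIn (.arith o i j k) s ((2 * L) ^ 2) (s.setReg i (o.eval (s.reg j) (s.reg k))) :=
  ⟨_, Nat.pow_le_pow_left (by have := hL _ hj; have := hL _ hk; omega) 2, .arith s o i j k⟩

theorem runsIn_load (hL : ∀ z : ℤ, |z| ≤ X → bits z ≤ L) (s : State) (i a : ℕ) {j : ℕ}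
    (hj : |s.reg j| ≤ X) (hm : |s.mem a (s.reg j).toNat| ≤ X) :
    RunsIn (.load i a j) s ((2 * L) ^ 2) (s.setReg i (s.mem a (s.reg j).toNat)) :=
  ⟨_, by have := hL _ hj; have := hL _ hm; have := le_two_mul_sq L; omega, .load s i a j⟩

theorem runsIn_store (hL : ∀ z : ℤ, |z| ≤ X → bits z ≤ L) (s : State) (a : ℕ) {i j : ℕ}
    (hi : |s.reg i| ≤ X) (hj : |s.reg j| ≤ X) :
    RunsIn (.store a i j) s ((2 * L) ^ 2) (s.setMem a (s.reg i).toNat (s.reg j)) :=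
  ⟨_, by have := hL _ hi; have := hL _ hj; have := le_two_mul_sq L; omega, .store s a i j⟩

/-- Evaluation of an expression is correct, does not disturb the variables and the intermediate
results in lower registers, and takes time proportional to the number of instructions. -/
theorem Expr.compile_runsIn (hL : ∀ z : ℤ, |z| ≤ X → bits z ≤ L) {B : ℤ} (hB : 2 ≤ B)
    {σ : State} (hσ : σ.Le B) (e : Expr) (he : B ^ e.degree ≤ X) (hBX : B ≤ X) (k : ℕ)
    {s : State} (hs : Represents s σ) :
    ∃ s', RunsIn (e.compile k) s (e.cost * (2 * L) ^ 2) s' ∧ Represents s' σ ∧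
      s'.reg (2 * k + 1) = e.eval σ ∧ ∀ l < k, s'.reg (2 * l + 1) = s.reg (2 * l + 1) := by
  have hB1 : 1 ≤ B := by linarith
  induction e generalizing k s with
  | var v =>
    -- The machine has no move instruction: a variable is copied by adding it to a register that was
    -- set to `0`.
    refine ⟨(s.setReg (2 * k + 1) 0).setReg (2 * k + 1) (σ.reg v), ?_,
      (hs.setReg_odd _ _).setReg_odd _ _, by simp, fun l hl => ?_⟩
    · have h1 := runsIn_const hL s (2 * k + 1) (z := 0) (by simp; linarith)
      have h2 := runsIn_arith hL (s.setReg (2 * k + 1) 0) .add (2 * k + 1) (j := 2 * v)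
        (k := 2 * k + 1) (by
          rw [State.setReg_reg, if_neg (by omega), hs.reg]
          exact (hσ.reg v).trans hBX) (by simp; linarith)
      have h3 : Op.add.eval ((s.setReg (2 * k + 1) 0).reg (2 * v))
          ((s.setReg (2 * k + 1) 0).reg (2 * k + 1)) = σ.reg v := by
        rw [State.setReg_reg, State.setReg_reg, if_neg (by omega), if_pos rfl, hs.reg]
        simp [Op.eval]
      rw [h3] at h2
      exact (h1.seq h2).mono (by simp only [Expr.cost]; omega)
    · rw [State.setReg_reg, State.setReg_reg, if_neg (by omega), if_neg (by omega)]
  | const z =>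
    refine ⟨s.setReg (2 * k + 1) z, ?_, hs.setReg_odd _ _, by simp [Expr.eval], fun l hl => ?_⟩
    · have := Expr.abs_eval_le hB hσ (.const z)
      exact (runsIn_const hL s _ (this.trans he)).mono (by simp [Expr.cost])
    · rw [State.setReg_reg, if_neg (by omega)]
  | op o e f ihe ihf =>
    simp only [Expr.degree] at he
    have hde : B ^ e.degree ≤ X := (pow_le_pow_right₀ hB1 (by omega)).trans he
    have hdf : B ^ f.degree ≤ X := (pow_le_pow_right₀ hB1 (by omega)).trans he
    obtain ⟨s₁, hr₁, hs₁, hv₁, hl₁⟩ := ihe hde k hs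
    obtain ⟨s₂, hr₂, hs₂, hv₂, hl₂⟩ := ihf hdf (k + 1) hs₁
    -- The value of `e` survives the evaluation of `f`, which uses only intermediate registers of
    -- index above `k`.
    have hv : s₂.reg (2 * k + 1) = e.eval σ := by rw [hl₂ k (by omega), hv₁]
    have h3 := runsIn_arith hL s₂ o (2 * k + 1) (j := 2 * k + 1) (k := 2 * (k + 1) + 1)
      (by rw [hv]; exact (Expr.abs_eval_le hB hσ e).trans hde)
      (by rw [hv₂]; exact (Expr.abs_eval_le hB hσ f).trans hdf)
    rw [hv, hv₂] at h3
    refine ⟨_, (hr₁.seq (hr₂.seq h3)).mono (by simp only [Expr.cost]; ring_nf; rfl),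
      hs₂.setReg_odd _ _, by simp [Expr.eval], fun l hl => ?_⟩
    rw [State.setReg_reg, if_neg (by omega), hl₂ l (by omega), hl₁ l hl]
  | read a e ih =>
    simp only [Expr.degree] at he
    have hde : B ^ e.degree ≤ X := (pow_le_pow_right₀ hB1 (by omega)).trans he
    obtain ⟨s₁, hr₁, hs₁, hv₁, hl₁⟩ := ih hde k hs
    have h3 := runsIn_load hL s₁ (2 * k + 1) a (j := 2 * k + 1)
      (by rw [hv₁]; exact (Expr.abs_eval_le hB hσ e).trans hde)
      (by rw [hs₁.mem]; exact (hσ.mem _ _).trans hBX)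
    rw [hv₁, hs₁.mem] at h3
    refine ⟨_, (hr₁.seq h3).mono (by simp only [Expr.cost]; ring_nf; rfl),
      hs₁.setReg_odd _ _, by simp, fun l hl => ?_⟩
    rw [State.setReg_reg, if_neg (by omega), hl₁ l hl]

end Instructions

/-- Commands; tests are for positivity. -/
inductive Cmd where
  | skip
  | set (v : ℕ) (e : Expr)
  | write (a : ℕ) (e f : Expr)
  | seq (c d : Cmd)
  | ite (e : Expr) (c d : Cmd)
  | loop (e : Expr) (c : Cmd)

namespace Cmd

/-- The machine program of a command. -/
def compile : Cmd → Prog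
  | skip => .skip
  | set v e => .seq (e.compile 0) (.seq (.const 3 0) (.arith .add (2 * v) 1 3))
  | write a e f => .seq (e.compile 0) (.seq (f.compile 1) (.store a 1 3))
  | seq c d => .seq c.compile d.compile
  | ite e c d => .seq (e.compile 0) (.cond 1 c.compile d.compile)
  | loop e c => .seq (e.compile 0) (.loop 1 (.seq c.compile (e.compile 0)))

/-- A bound for the number of executed instructions if no loop runs more than `K` times, as a
polynomial in `K`. -/
noncomputable def cost : Cmd → Polynomial ℕ
  | skip => 1
  | set _ e => ((e.cost + 2 : ℕ) : Polynomial ℕ)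
  | write _ e f => ((e.cost + f.cost + 1 : ℕ) : Polynomial ℕ)
  | seq c d => c.cost + d.cost
  | ite e c d => ((e.cost + 1 : ℕ) : Polynomial ℕ) + (c.cost + d.cost)
  | loop e c =>
    ((e.cost + 1 : ℕ) : Polynomial ℕ) + Polynomial.X * (((e.cost + 1 : ℕ) : Polynomial ℕ) + c.cost)

/-- The maximal degree of an expression in a command. -/
def degree : Cmd → ℕ
  | skip => 1
  | set _ e => max 1 e.degree
  | write _ e f => max 1 (max e.degree f.degree)
  | seq c d => max c.degree d.degree
  | ite e c d => max e.degree (max c.degree d.degree)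
  | loop e c => max e.degree c.degree

/-- Guarantees `B ≤ B ^ c.degree`, so that the bound `X` on intermediate values also covers the
stored numbers. -/
theorem one_le_degree (c : Cmd) : 1 ≤ c.degree := by
  induction c <;> simp_all [degree]

/-- Weakest precondition of a loop with at most `K` iterations. -/
def loopWp (e : Expr) (w : (State → Prop) → State → Prop) (Q : State → Prop) : ℕ → State → Prop
  | 0, s => e.eval s ≤ 0 ∧ Q s
  | K + 1, s => (e.eval s ≤ 0 ∧ Q s) ∨ (0 < e.eval s ∧ w (loopWp e w Q K) s)

/-- Weakest precondition: the command halts in a state with `Q`, writes only numbers of absolute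
value at most `B`, and iterates each loop at most `K` times. -/
def wp (B : ℤ) (K : ℕ) : Cmd → (State → Prop) → State → Prop
  | skip, Q, s => Q s
  | set v e, Q, s => |e.eval s| ≤ B ∧ Q (s.setReg v (e.eval s))
  | write a e f, Q, s => |f.eval s| ≤ B ∧ Q (s.setMem a (e.eval s).toNat (f.eval s))
  | seq c d, Q, s => c.wp B K (d.wp B K Q) s
  | ite e c d, Q, s => (0 < e.eval s → c.wp B K Q s) ∧ (e.eval s ≤ 0 → d.wp B K Q s)
  | loop e c, Q, s => loopWp e (c.wp B K) Q K s

/-- The precondition bounds only what is stored; intermediate values are at most `X` because their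
degrees are at most `c.degree`. So every instruction and every test costs at most `(2 * L) ^ 2`, and
it remains to count them by induction on the command. -/
theorem runsIn_compile {B X : ℤ} {K L : ℕ} (hL : ∀ z : ℤ, |z| ≤ X → bits z ≤ L) (hB : 2 ≤ B)
    (c : Cmd) (hc : B ^ c.degree ≤ X) {Q : State → Prop} {σ s : State} (hσ : σ.Le B)
    (hs : Represents s σ) (h : c.wp B K Q σ) :
    ∃ s' σ', RunsIn c.compile s (c.cost.eval K * (2 * L) ^ 2) s' ∧ σ'.Le B ∧ Represents s' σ' ∧
      Q σ' := by
  have hB1 : 1 ≤ B := by linarith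
  have hBX : B ≤ X :=
    (le_self_pow₀ hB1 (by have := c.one_le_degree; omega)).trans hc
  have hL1 : 1 ≤ L := (one_le_bits 0).trans (hL 0 (by simp; linarith))
  have hcond : ∀ z : ℤ, |z| ≤ X → bits z ≤ (2 * L) ^ 2 := fun z hz => by
    have := hL z hz; have := le_two_mul_sq L; omega
  have hpos : 1 ≤ (2 * L) ^ 2 := Nat.one_le_pow _ _ (by omega)
  have hdeg : ∀ {d}, d ≤ c.degree → B ^ d ≤ X := fun h => (pow_le_pow_right₀ hB1 h).trans hc
  clear hc
  induction c generalizing Q σ s with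
  | skip => exact ⟨s, σ, ⟨1, by simpa [cost] using hpos, .skip s⟩, hσ, hs, h⟩
  | set v e =>
    obtain ⟨s₁, hr₁, hs₁, hv₁, -⟩ :=
      e.compile_runsIn hL hB hσ (hdeg (by simp [degree])) hBX 0 hs
    have h2 := runsIn_const hL s₁ 3 (z := 0) (by simp; linarith)
    have h3 := runsIn_arith hL (s₁.setReg 3 0) .add (2 * v) (j := 1) (k := 3)
      (by simpa [hv₁] using h.1.trans hBX) (by simp; linarith)
    have h4 : Op.add.eval ((s₁.setReg 3 0).reg 1) ((s₁.setReg 3 0).reg 3) = e.eval σ := by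
      simpa [Op.eval] using hv₁
    rw [h4] at h3
    refine ⟨_, _, (hr₁.seq (h2.seq h3)).mono ?_, hσ.setReg v h.1,
      (hs₁.setReg_odd 1 0).setReg v _, h.2⟩
    simp only [cost, Polynomial.eval_natCast]
    push_cast
    ring_nf; rfl
  | write a e f =>
    obtain ⟨s₁, hr₁, hs₁, hv₁, -⟩ :=
      e.compile_runsIn hL hB hσ (hdeg (by simp [degree])) hBX 0 hs
    obtain ⟨s₂, hr₂, hs₂, hv₂, hl₂⟩ :=
      f.compile_runsIn hL hB hσ (hdeg (by simp [degree])) hBX 1 hs₁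
    have hv : s₂.reg 1 = e.eval σ := by rw [← hv₁]; exact hl₂ 0 one_pos
    have hv₂' : s₂.reg 3 = f.eval σ := hv₂
    have h3 := runsIn_store hL s₂ a (i := 1) (j := 3)
      (by rw [hv]; exact (Expr.abs_eval_le hB hσ e).trans (hdeg (by simp [degree])))
      (by rw [hv₂']; exact h.1.trans hBX)
    rw [hv, hv₂'] at h3
    refine ⟨_, _, (hr₁.seq (hr₂.seq h3)).mono ?_, hσ.setMem a _ h.1, hs₂.setMem a _ _, h.2⟩
    simp only [cost, Polynomial.eval_natCast]
    push_cast
    ring_nf; rfl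
  | seq c d ihc ihd =>
    obtain ⟨s₁, σ₁, hr₁, hσ₁, hs₁, h₁⟩ :=
      ihc hσ hs h (fun h => hdeg (h.trans (by simp [degree])))
    obtain ⟨s₂, σ₂, hr₂, hσ₂, hs₂, h₂⟩ :=
      ihd hσ₁ hs₁ h₁ (fun h => hdeg (h.trans (by simp [degree])))
    refine ⟨s₂, σ₂, (hr₁.seq hr₂).mono ?_, hσ₂, hs₂, h₂⟩
    simp only [cost, Polynomial.eval_add, add_mul, le_refl]
  | ite e c d ihc ihd =>
    obtain ⟨s₁, hr₁, hs₁, hv₁, -⟩ :=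
      e.compile_runsIn hL hB hσ (hdeg (by simp [degree])) hBX 0 hs
    have hv₁ : s₁.reg 1 = e.eval σ := hv₁
    have hb : bits (s₁.reg 1) ≤ (2 * L) ^ 2 := by
      rw [hv₁]
      exact hcond _ ((Expr.abs_eval_le hB hσ e).trans (hdeg (by simp [degree])))
    by_cases hpos : 0 < e.eval σ
    · obtain ⟨s₂, σ₂, ⟨t, ht, hr₂⟩, hσ₂, hs₂, h₂⟩ :=
        ihc hσ hs₁ (h.1 hpos) (fun h => hdeg (h.trans (by simp [degree])))
      have h3 : RunsIn (.cond 1 c.compile d.compile) s₁ _ s₂ :=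
        ⟨_, le_rfl, .condTrue (by rwa [hv₁]) hr₂⟩
      refine ⟨s₂, σ₂, (hr₁.seq h3).mono ?_, hσ₂, hs₂, h₂⟩
      simp only [cost, Polynomial.eval_add, Polynomial.eval_natCast]
      push_cast
      nlinarith [Nat.zero_le (d.cost.eval K * (2 * L) ^ 2)]
    · obtain ⟨s₂, σ₂, ⟨t, ht, hr₂⟩, hσ₂, hs₂, h₂⟩ :=
        ihd hσ hs₁ (h.2 (not_lt.mp hpos)) (fun h => hdeg (h.trans (by simp [degree])))
      have h3 : RunsIn (.cond 1 c.compile d.compile) s₁ _ s₂ :=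
        ⟨_, le_rfl, .condFalse (by rw [hv₁]; exact not_lt.mp hpos) hr₂⟩
      refine ⟨s₂, σ₂, (hr₁.seq h3).mono ?_, hσ₂, hs₂, h₂⟩
      simp only [cost, Polynomial.eval_add, Polynomial.eval_natCast]
      push_cast
      nlinarith [Nat.zero_le (c.cost.eval K * (2 * L) ^ 2)]
  | loop e c ih =>
    obtain ⟨s₁, hr₁, hs₁, hv₁, -⟩ :=
      e.compile_runsIn hL hB hσ (hdeg (by simp [degree])) hBX 0 hs
    have hv₁ : s₁.reg 1 = e.eval σ := hv₁
    -- Inner induction on the number `k` of iterations still allowed. The outer hypothesis is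
    -- applied to the body with the precondition of the remaining loop as its postcondition.
    have key : ∀ (k : ℕ) (σ s : State), σ.Le B → Represents s σ → s.reg 1 = e.eval σ →
        loopWp e (c.wp B K) Q k σ → ∃ s' σ',
        RunsIn (.loop 1 (.seq c.compile (e.compile 0))) s
          ((1 + k * (e.cost + 1 + c.cost.eval K)) * (2 * L) ^ 2) s' ∧ σ'.Le B ∧
          Represents s' σ' ∧ Q σ' := by
      have hhalt : ∀ (k : ℕ) (σ s : State), σ.Le B → Represents s σ → s.reg 1 = e.eval σ →
          e.eval σ ≤ 0 → Q σ → ∃ s' σ', RunsIn (.loop 1 (.seq c.compile (e.compile 0))) s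
          ((1 + k * (e.cost + 1 + c.cost.eval K)) * (2 * L) ^ 2) s' ∧ σ'.Le B ∧
          Represents s' σ' ∧ Q σ' := by
        intro k σ s hσ hs hv h0 hQ
        refine ⟨s, σ, ⟨_, ?_, .loopFalse (by rwa [hv])⟩, hσ, hs, hQ⟩
        rw [hv]
        refine (hcond _ ((Expr.abs_eval_le hB hσ e).trans (hdeg (by simp [degree])))).trans ?_
        exact Nat.le_mul_of_pos_left _ (by omega)
      intro k
      induction k with
      | zero => intro σ s hσ hs hv h; exact hhalt 0 σ s hσ hs hv h.1 h.2
      | succ k ihk =>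
        intro σ s hσ hs hv h
        rcases h with h | ⟨hpos, h⟩
        · exact hhalt _ σ s hσ hs hv h.1 h.2
        · obtain ⟨s₂, σ₂, hr₂, hσ₂, hs₂, h₂⟩ :=
            ih hσ hs h (fun h => hdeg (h.trans (by simp [degree])))
          obtain ⟨s₃, hr₃, hs₃, hv₃, -⟩ :=
            e.compile_runsIn hL hB hσ₂ (hdeg (by simp [degree])) hBX 0 hs₂
          obtain ⟨s₄, σ₄, ⟨t', ht', hr₄⟩, hσ₄, hs₄, h₄⟩ := ihk σ₂ s₃ hσ₂ hs₃ hv₃ h₂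
          obtain ⟨t, ht, hr⟩ := hr₂.seq hr₃
          refine ⟨s₄, σ₄, ⟨_, ?_, .loopTrue (by rwa [hv]) hr hr₄⟩, hσ₄, hs₄, h₄⟩
          have : bits (s.reg 1) ≤ (2 * L) ^ 2 := by
            rw [hv]
            exact hcond _ ((Expr.abs_eval_le hB hσ e).trans (hdeg (by simp [degree])))
          nlinarith
    obtain ⟨s₂, σ₂, hr₂, hσ₂, hs₂, h₂⟩ := key K σ s₁ hσ hs₁ hv₁ h
    refine ⟨s₂, σ₂, (hr₁.seq hr₂).mono ?_, hσ₂, hs₂, h₂⟩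
    simp only [cost, Polynomial.eval_add, Polynomial.eval_mul, Polynomial.eval_X,
      Polynomial.eval_natCast]
    push_cast
    ring_nf; rfl

/-- The variables that a command may change. -/
def regs : Cmd → List ℕ
  | skip => []
  | set v _ => [v]
  | write _ _ _ => []
  | seq c d => c.regs ++ d.regs
  | ite _ c d => c.regs ++ d.regs
  | loop _ c => c.regs

/-- The arrays that a command may change. -/
def arrays : Cmd → List ℕ
  | skip => []
  | set _ _ => []
  | write a _ _ => [a]
  | seq c d => c.arrays ++ d.arrays
  | ite _ c d => c.arrays ++ d.arrays
  | loop _ c => c.arrays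

/-- The states `s` and `t` agree outside of what the command may change. -/
structure Frame (c : Cmd) (s t : State) : Prop where
  reg : ∀ v, v ∉ c.regs → t.reg v = s.reg v
  mem : ∀ a, a ∉ c.arrays → t.mem a = s.mem a

theorem Frame.refl (c : Cmd) (s : State) : c.Frame s s := ⟨fun _ _ => rfl, fun _ _ => rfl⟩

theorem Frame.trans {c : Cmd} {s t u : State} (h : c.Frame s t) (h' : c.Frame t u) :
    c.Frame s u :=
  ⟨fun v hv => (h'.reg v hv).trans (h.reg v hv), fun a ha => (h'.mem a ha).trans (h.mem a ha)⟩

theorem Frame.mono {c d : Cmd} {s t : State} (h : c.Frame s t) (hr : c.regs ⊆ d.regs)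
    (ha : c.arrays ⊆ d.arrays) : d.Frame s t :=
  ⟨fun v hv => h.reg v (fun h => hv (hr h)), fun a hv => h.mem a (fun h => hv (ha h))⟩

theorem loopWp_mono {e : Expr} {w : (State → Prop) → State → Prop}
    (hw : ∀ (Q Q' : State → Prop) (s), (∀ s, Q s → Q' s) → w Q s → w Q' s)
    {Q Q' : State → Prop} (h : ∀ s, Q s → Q' s) (K : ℕ) (s : State) (hs : loopWp e w Q K s) :
    loopWp e w Q' K s := by
  induction K generalizing s with
  | zero => exact ⟨hs.1, h _ hs.2⟩
  | succ K ih =>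
    rcases hs with hs | hs
    · exact .inl ⟨hs.1, h _ hs.2⟩
    · exact .inr ⟨hs.1, hw _ _ _ ih hs.2⟩

/-! ### Rules for weakest preconditions -/

variable {B : ℤ} {K : ℕ}

theorem wp_mono {c : Cmd} {Q Q' : State → Prop} {s : State} (h : ∀ s, Q s → Q' s)
    (hs : c.wp B K Q s) : c.wp B K Q' s := by
  induction c generalizing Q Q' s with
  | skip => exact h _ hs
  | set v e => exact ⟨hs.1, h _ hs.2⟩
  | write a e f => exact ⟨hs.1, h _ hs.2⟩
  | seq c d ihc ihd => exact ihc (fun _ => ihd h) hs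
  | ite e c d ihc ihd => exact ⟨fun h' => ihc h (hs.1 h'), fun h' => ihd h (hs.2 h')⟩
  | loop e c ih => exact loopWp_mono (w := c.wp B K) (fun _ _ _ => ih) h K s hs

/-- What a command cannot change may be used in its postcondition. -/
theorem wp_frame {c : Cmd} {Q : State → Prop} {s : State}
    (hs : c.wp B K (fun t => c.Frame s t → Q t) s) : c.wp B K Q s := by
  induction c generalizing Q s with
  | skip => exact hs ⟨fun _ _ => rfl, fun _ _ => rfl⟩
  | set v e =>
    refine ⟨hs.1, hs.2 ⟨fun w hw => ?_, fun _ _ => rfl⟩⟩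
    simp only [regs, List.mem_singleton] at hw
    simp [hw]
  | write a e f =>
    refine ⟨hs.1, hs.2 ⟨fun _ _ => rfl, fun b hb => ?_⟩⟩
    simp only [arrays, List.mem_singleton] at hb
    simp [hb]
  | seq c d ihc ihd =>
    refine ihc (wp_mono (fun t ht hf => ihd (wp_mono (fun u hu hf' => hu ?_) ht)) hs)
    exact (hf.mono (by simp [regs]) (by simp [arrays])).trans
      (hf'.mono (by simp [regs]) (by simp [arrays]))
  | ite e c d ihc ihd =>
    exact ⟨fun h => ihc (wp_mono (fun t ht hf => ht
      (hf.mono (by simp [regs]) (by simp [arrays]))) (hs.1 h)),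
      fun h => ihd (wp_mono (fun t ht hf => ht
      (hf.mono (by simp [regs]) (by simp [arrays]))) (hs.2 h))⟩
  | loop e c ih =>
    have key : ∀ (k : ℕ) (t : State), c.Frame s t →
        loopWp e (c.wp B K) (fun t => (loop e c).Frame s t → Q t) k t →
        loopWp e (c.wp B K) Q k t := by
      intro k
      induction k with
      | zero =>
        exact fun t ht h => ⟨h.1, h.2 (ht.mono (by simp [regs]) (by simp [arrays]))⟩
      | succ k ihk =>
        rintro t ht (h | h)
        · exact .inl ⟨h.1, h.2 (ht.mono (by simp [regs]) (by simp [arrays]))⟩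
        · exact .inr ⟨h.1, ih (wp_mono (fun u hu hf => ihk u (ht.trans hf) hu) h.2)⟩
    exact key K s (Frame.refl c s) hs

/-- `forTo i e c` runs `c` and increments the variable `i` until it reaches `e`. -/
def forTo (i : ℕ) (e : Expr) (c : Cmd) : Cmd :=
  loop (e - .var i) (seq c (set i (.var i + 1)))

/-- `I k` is the invariant when the counter is `k`. The frame of the whole loop is available in
every iteration, so facts about untouched registers and arrays need not be part of `I`. The
postcondition of the body refers to the state after the increment. The bound `b ≤ B` is required
because the counter is itself stored. -/
theorem wp_forTo {i : ℕ} {e : Expr} {c : Cmd} {Q : State → Prop} {s : State} {a b : ℕ}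
    (I : ℕ → State → Prop) (hi : i ∉ c.regs) (ha : s.reg i = a) (hab : a ≤ b)
    (hK : b ≤ a + K) (hB : (b : ℤ) ≤ B)
    (he : ∀ t, (forTo i e c).Frame s t → e.eval t = b) (h0 : I a s)
    (hstep : ∀ k t, a ≤ k → k < b → t.reg i = (k : ℤ) → (forTo i e c).Frame s t → I k t →
      c.wp B K (fun u => I (k + 1) (u.setReg i (k + 1 : ℕ))) t)
    (hQ : ∀ t, t.reg i = (b : ℤ) → (forTo i e c).Frame s t → I b t → Q t) :
    (forTo i e c).wp B K Q s := by
  have key : ∀ (l k : ℕ) (t : State), k ≤ b → b - k ≤ l → a ≤ k → t.reg i = (k : ℤ) →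
      (forTo i e c).Frame s t → I k t →
      loopWp (e - .var i) ((seq c (set i (.var i + 1))).wp B K) Q l t := by
    intro l
    induction l with
    | zero =>
      intro k t hk hl ha hr hf hI
      obtain rfl : k = b := by omega
      refine ⟨?_, hQ t hr hf hI⟩
      simp [he t hf, hr]
    | succ l ih =>
      intro k t hk hl ha hr hf hI
      rcases hk.eq_or_lt with rfl | hkb
      · refine .inl ⟨?_, hQ t hr hf hI⟩
        simp [he t hf, hr]
      · refine .inr ⟨by simp [he t hf, hr, hkb], ?_⟩
        refine wp_frame (c := seq c (set i (.var i + 1))) ?_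
        refine wp_frame (c := c) ?_
        refine wp_mono (fun u hu hf' => ?_) (hstep k t ha hkb hr hf hI)
        have hr' : u.reg i = k := (hf'.reg i hi).trans hr
        refine ⟨?_, fun hf'' => ih (k + 1) _ hkb (by omega) (by omega) (by simp [hr'])
          (hf.trans (hf''.mono (by simp [forTo, regs]) (by simp [forTo, arrays]))) ?_⟩
        · simp only [Expr.eval_add, Expr.eval_var, hr', Expr.eval_one]
          rw [abs_of_nonneg (by positivity)]
          have : ((k + 1 : ℕ) : ℤ) ≤ b := by exact_mod_cast hkb
          push_cast at this
          linarith
        · simpa [hr'] using hu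
  exact key K a s hab (by omega) le_rfl ha (Frame.refl _ _) h0

end Cmd

/-! ### From commands to polynomial time -/

theorem bits_le_of_abs_le {z : ℤ} {E : ℕ} (h : |z| ≤ 2 ^ E) : bits z ≤ E + 2 := by
  have h1 : z.natAbs < 2 ^ (E + 1) := by
    have h2 : ((z.natAbs : ℕ) : ℤ) ≤ (2 ^ E : ℕ) := by
      rw [← Int.abs_eq_natAbs]; exact_mod_cast h
    have h3 : 2 ^ E < 2 ^ (E + 1) := Nat.pow_lt_pow_right one_lt_two (by omega)
    omega
  have := Nat.size_le.mpr h1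
  unfold bits
  omega

/-- A problem is decidable in polynomial time if a command decides it such that the binary lengths
of all numbers and the numbers of iterations of all loops are bounded by a polynomial `E`. -/
theorem decidableInPolyTime_of_wp {α : Type} {encode : α → List ℤ} {size : α → ℕ} {Q : α → Prop}
    (c : Cmd) (E : Polynomial ℕ) (hE : ∀ a, 1 ≤ E.eval (size a))
    (hw : ∀ a, ∀ z ∈ encode a, |z| ≤ 2 ^ E.eval (size a))
    (h : ∀ a, c.wp (2 ^ E.eval (size a)) (E.eval (size a))
      (fun s => (Q a ∧ s.reg 0 = 1) ∨ (¬ Q a ∧ s.reg 0 = 0)) (init (encode a))) :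
    DecidableInPolyTime encode size Q := by
  -- Number of instructions for at most `E` iterations per loop, times `(2 * L) ^ 2`, where `L = E *
  -- c.degree + 2` bounds the length of the numbers up to `(2 ^ E) ^ c.degree`.
  refine ⟨c.compile, c.cost.comp E * (2 * (E * (c.degree : Polynomial ℕ) + 2)) ^ 2, fun a => ?_⟩
  set e := E.eval (size a) with he
  have hmem : (init (encode a)).Le (2 ^ e) := by
    refine ⟨fun v => by simp [init], fun b k => ?_⟩
    simp only [init]
    split_ifs
    · rw [List.getD_eq_getElem?_getD]
      cases hk : (encode a)[k]? with
      | none => simp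
      | some z => simpa using hw a z (List.mem_of_getElem? hk)
    · simp
  obtain ⟨s, σ, ⟨t, ht, hr⟩, -, hs, hQ⟩ := c.runsIn_compile (L := e * c.degree + 2)
    (X := 2 ^ (e * c.degree)) (fun z hz => bits_le_of_abs_le hz)
    (le_self_pow₀ (one_le_two) (by have := hE a; omega)) (le_of_eq (pow_mul _ _ _).symm) hmem
    (⟨fun v => by simp [init], rfl⟩ : Represents (init (encode a)) (init (encode a))) (h a)
  refine ⟨t, s, hr, ht.trans (le_of_eq ?_), ?_⟩
  · simp [Polynomial.eval_comp, ← he]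
  · have := hs.reg 0
    simp only [mul_zero] at this
    rwa [this]

end BitRAM

/-! # Bounds on `p`-adic valuations -/

/-- `p ^ k` divides `x` locally at `p`. -/
def ValGe (p : ℕ) (k : ℤ) (x : ℚ) : Prop := x = 0 ∨ k ≤ padicValRat p x

/-- `x` is nonzero with `p`-adic valuation `k`. -/
def ValEq (p : ℕ) (k : ℤ) (x : ℚ) : Prop := x ≠ 0 ∧ padicValRat p x = k

section Valuation

variable {p : ℕ} {k l : ℤ} {x y : ℚ}

theorem valGe_zero : ValGe p k 0 := .inl rfl

theorem ValGe.mono (h : ValGe p k x) (hl : l ≤ k) : ValGe p l x :=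
  h.imp_right hl.trans

theorem ValEq.valGe (h : ValEq p k x) : ValGe p k x := .inr h.2.ge

theorem ValGe.neg (h : ValGe p k x) : ValGe p k (-x) := by
  rcases h with rfl | h
  · exact .inl neg_zero
  · exact .inr (by rwa [padicValRat.neg])

variable [hp : Fact p.Prime]

theorem ValGe.add (hx : ValGe p k x) (hy : ValGe p k y) : ValGe p k (x + y) := by
  rcases hx with rfl | hx
  · simpa using hy
  rcases hy with rfl | hy
  · rw [add_zero]; exact .inr hx
  by_cases h : x + y = 0
  · exact .inl h
  · exact .inr ((le_min hx hy).trans (padicValRat.min_le_padicValRat_add h))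

theorem ValGe.sub (hx : ValGe p k x) (hy : ValGe p k y) : ValGe p k (x - y) := by
  rw [sub_eq_add_neg]; exact hx.add hy.neg

theorem ValGe.sum {ι : Type*} {s : Finset ι} {f : ι → ℚ} (h : ∀ i ∈ s, ValGe p k (f i)) :
    ValGe p k (∑ i ∈ s, f i) :=
  Finset.sum_induction f (ValGe p k) (fun _ _ => ValGe.add) valGe_zero h

theorem ValGe.add_iff_left (hy : ValGe p k y) : ValGe p k (x + y) ↔ ValGe p k x :=
  ⟨fun h => by simpa using h.sub hy, fun h => h.add hy⟩

theorem valGe_mul_iff {a : ℚ} (ha : a ≠ 0) :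
    ValGe p (padicValRat p a + k) (a * x) ↔ ValGe p k x := by
  by_cases hx : x = 0
  · simp [hx, valGe_zero]
  · simp [ValGe, ha, hx, padicValRat.mul]

theorem valEq_mul_iff {a : ℚ} (ha : a ≠ 0) :
    ValEq p (padicValRat p a + k) (a * x) ↔ ValEq p k x := by
  by_cases hx : x = 0
  · simp [hx, ValEq]
  · simp [ValEq, ha, hx, padicValRat.mul]

theorem ValEq.add_valGe (hx : ValEq p k x) (hy : ValGe p (k + 1) y) : ValEq p k (x + y) := by
  rcases hy with rfl | hy
  · simpa using hx
  by_cases hy0 : y = 0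
  · simpa [hy0] using hx
  have hlt : padicValRat p x < padicValRat p y := by rw [hx.2]; omega
  have hxy : x + y ≠ 0 := by
    intro h
    rw [eq_neg_of_add_eq_zero_left h, padicValRat.neg] at hlt
    exact lt_irrefl _ hlt
  exact ⟨hxy, by rw [padicValRat.add_eq_of_lt hxy hx.1 hy0 hlt, hx.2]⟩

theorem valEq_zpow : ValEq p k ((p : ℚ) ^ k) :=
  ⟨zpow_ne_zero _ (by exact_mod_cast hp.out.ne_zero), by
    rw [padicValRat.zpow, padicValRat.self hp.out.one_lt, mul_one]⟩

end Valuation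

/-- A unit at `2` has odd numerator and odd denominator in lowest terms, so their difference is
even. -/
theorem valGe_one_sub_one {u : ℚ} (hu : ValEq 2 0 u) : ValGe 2 1 (u - 1) := by
  obtain ⟨hu0, hv⟩ := hu
  rw [padicValRat_def] at hv
  have hnum : u.num ≠ 0 := Rat.num_ne_zero.mpr hu0
  have hden : ¬ (2 : ℕ) ∣ u.den := by
    intro h
    have h1 := one_le_padicValNat_of_dvd u.den_nz h
    have h2 : (2 : ℕ) ∣ u.num.natAbs :=
      dvd_of_one_le_padicValNat (by unfold padicValInt at hv; omega)
    have := Nat.dvd_gcd h2 h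
    rw [u.reduced] at this
    omega
  have h2 : ¬ (2 : ℕ) ∣ u.num.natAbs := by
    intro h
    have h1 := one_le_padicValNat_of_dvd (Int.natAbs_ne_zero.mpr hnum) h
    have h3 := padicValNat.eq_zero_of_not_dvd hden
    unfold padicValInt at hv
    omega
  have h3 : u - 1 = ((u.num - u.den : ℤ) : ℚ) * ((u.den : ℚ))⁻¹ := by
    have : (u.den : ℚ) ≠ 0 := by exact_mod_cast u.den_nz
    push_cast
    rw [sub_mul, mul_inv_cancel₀ this, ← div_eq_mul_inv, Rat.num_div_den]
  by_cases h : u.num - u.den = 0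
  · left; rw [h3, h]; simp
  · right
    have hd : ((u.den : ℚ))⁻¹ ≠ 0 := inv_ne_zero (by exact_mod_cast u.den_nz)
    rw [h3, padicValRat.mul (by exact_mod_cast h) hd, padicValRat.inv, padicValRat.of_nat,
      padicValNat.eq_zero_of_not_dvd hden, padicValRat.of_int]
    have : 1 ≤ padicValInt 2 (u.num - u.den) :=
      one_le_padicValNat_of_dvd (Int.natAbs_ne_zero.mpr h) (by omega)
    push_cast
    omega

/-- The quotient `x / y` is a unit at `2`, hence congruent to `1`; multiply by `y`. -/
theorem ValEq.sub_two {k : ℤ} {x y : ℚ} (hx : ValEq 2 k x) (hy : ValEq 2 k y) :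
    ValGe 2 (k + 1) (x - y) := by
  have h : x - y = y * (x / y - 1) := by field_simp [hy.1]
  have h1 : ValEq 2 0 (x / y) :=
    ⟨div_ne_zero hx.1 hy.1, by rw [padicValRat.div hx.1 hy.1, hx.2, hy.2, sub_self]⟩
  rw [h, ← hy.2, valGe_mul_iff hy.1]
  exact valGe_one_sub_one h1

/-- Here `p = 2` matters: the numbers of valuation `k - 1` form one coset modulo `2 ^ k`, whereas
for a prime `p` they form `p - 1` cosets modulo `p ^ k`. -/
theorem valEq_two_iff {k : ℤ} {x : ℚ} : ValEq 2 (k - 1) x ↔ ValGe 2 k (x - 2 ^ (k - 1)) := by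
  have h2 : ValEq 2 (k - 1) ((2 : ℚ) ^ (k - 1)) := by simpa using valEq_zpow (p := 2) (k := k - 1)
  constructor
  · intro h
    simpa using h.sub_two h2
  · intro h
    rw [← add_sub_cancel ((2 : ℚ) ^ (k - 1)) x]
    exact h2.add_valGe (by simpa using h)

/-! # The coset constraints on the variables -/

/-- The constraint on a variable: `c` is a lower bound for its valuation, and if `δ` holds then the
valuation is equal to `c` unless `c = -∞`. -/
def Admissible (p : ℕ) (c : WithBot ℤ) (δ : Bool) (x : ℚ) : Prop :=
  ∀ k : ℤ, c = k → if δ then ValEq p k x else ValGe p k x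

theorem exists_admissible {p : ℕ} [hp : Fact p.Prime] (c : WithBot ℤ) (δ : Bool) :
    ∃ x, Admissible p c δ x := by
  induction c with
  | bot => exact ⟨0, fun k hk => absurd hk.symm (WithBot.coe_ne_bot)⟩
  | coe k =>
    refine ⟨(p : ℚ) ^ k, fun l hl => ?_⟩
    obtain rfl : k = l := WithBot.coe_injective hl
    split_ifs
    exacts [valEq_zpow, valEq_zpow.valGe]

/-- For an admissible `x`, a lower bound of the valuation of `a * x`, up to a summand
`p ^ (w - 1)` if `δ` holds. -/
def weight (p : ℕ) (c : WithBot ℤ) (δ : Bool) (a : ℤ) : ℤ :=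
  padicValInt p a + c.unbotD 0 + δ.toNat

/-- Multiplication by `a` shifts valuations by `v_p(a)`, and an exact valuation at `2` is membership
in a coset by `valEq_two_iff`. Since `c ≠ ⊥`, the default value in `weight` plays no role. -/
theorem admissible_iff_valGe {p : ℕ} [Fact p.Prime] {c : WithBot ℤ} {δ : Bool} (hδ : δ → p = 2)
    (hc : c ≠ ⊥) {a : ℤ} (ha : a ≠ 0) (x : ℚ) :
    Admissible p c δ x ↔ ValGe p (weight p c δ a)
      (a * x - if δ then (p : ℚ) ^ (weight p c δ a - 1) else 0) := by
  have ha' : (a : ℚ) ≠ 0 := by exact_mod_cast ha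
  obtain ⟨k, rfl⟩ := WithBot.ne_bot_iff_exists.mp hc
  have h : Admissible p k δ x ↔ if δ then ValEq p k x else ValGe p k x :=
    ⟨fun h => h k rfl, fun h l hl => by rwa [← WithBot.coe_injective hl]⟩
  rw [h]
  cases δ with
  | false =>
    have : weight p k false a = padicValRat p (a : ℚ) + k := by simp [weight]
    simpa [this] using (valGe_mul_iff ha').symm
  | true =>
    obtain rfl := hδ rfl
    have : weight 2 k true a = padicValRat 2 (a : ℚ) + k + 1 := by simp [weight]
    simp only [if_true, this]
    have h2 := valEq_two_iff (k := padicValRat 2 (a : ℚ) + k + 1) (x := a * x)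
    rw [add_sub_cancel_right, valEq_mul_iff ha'] at h2
    rw [add_sub_cancel_right]
    exact_mod_cast h2

/-- In an equation `∑ a j * x j = β` whose other variables are admissible, a variable of minimal
weight is admissible if and only if the right-hand side passes a test. -/
theorem admissible_pivot_iff {p n : ℕ} [hp : Fact p.Prime] {c : ℕ → WithBot ℤ} {δ : ℕ → Bool}
    (hδ : ∀ j, δ j → p = 2) {a : ℕ → ℤ} {β : ℚ} {x : ℕ → ℚ} {i : ℕ} (hi : i < n) (hai : a i ≠ 0)
    (hc : ∀ j < n, a j ≠ 0 → c j ≠ ⊥ ∧ weight p (c i) (δ i) (a i) ≤ weight p (c j) (δ j) (a j))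
    (hx : ∀ j < n, j ≠ i → Admissible p (c j) (δ j) (x j))
    (hβ : ∑ j ∈ Finset.range n, a j * x j = β) :
    Admissible p (c i) (δ i) (x i) ↔
      if Odd (∑ j ∈ Finset.range n, if a j ≠ 0 ∧
          weight p (c j) (δ j) (a j) = weight p (c i) (δ i) (a i) then (δ j).toNat else 0)
      then ValEq p (weight p (c i) (δ i) (a i) - 1) β
      else ValGe p (weight p (c i) (δ i) (a i)) β := by
  set w := fun j => weight p (c j) (δ j) (a j) with hw
  set g := w i with hg
  set N := ∑ j ∈ Finset.range n, if a j ≠ 0 ∧ w j = g then (δ j).toNat else 0 with hN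
  set h : ℚ := (p : ℚ) ^ (g - 1) with hh
  -- `e j` represents the coset of `a j * x j` modulo `p ^ g`. It is zero for columns of larger
  -- weight.
  set e : ℕ → ℚ := fun j => ((if a j ≠ 0 ∧ w j = g then (δ j).toNat else 0 : ℕ) : ℚ) * h with he
  have he' : ∀ j, a j ≠ 0 → w j = g → e j = if δ j then (p : ℚ) ^ (w j - 1) else 0 := by
    intro j haj hwj
    simp only [he, hh]
    rw [if_pos ⟨haj, hwj⟩, hwj]
    cases δ j <;> simp
  have hterm : ∀ j ∈ Finset.range n \ {i}, ValGe p g (a j * x j - e j) := by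
    intro j hj
    simp only [Finset.mem_sdiff, Finset.mem_range, Finset.mem_singleton] at hj
    by_cases haj : a j = 0
    · simpa [haj, he] using valGe_zero
    obtain ⟨hcj, hle⟩ := hc j hj.1 haj
    have h1 : ValGe p (w j) (a j * x j - if δ j then (p : ℚ) ^ (w j - 1) else 0) :=
      (admissible_iff_valGe (hδ j) hcj haj (x j)).mp (hx j hj.1 hj.2)
    by_cases hwj : w j = g
    · rw [he' j haj hwj]
      exact h1.mono hle
    · have hej : e j = 0 := by simp [he, hwj]
      have hlt : g < w j := lt_of_le_of_ne hle (Ne.symm hwj)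
      rw [hej, sub_zero]
      -- From `g < w j` follows `g ≤ w j - 1`, so even the shifted coset of column `j` lies in `p ^
      -- g * ℤ_(p)`.
      have h2 : ValGe p g (if δ j then (p : ℚ) ^ (w j - 1) else 0) := by
        split_ifs
        · exact valEq_zpow.valGe.mono (by omega)
        · exact valGe_zero
      simpa using (h1.mono hle).add h2
  have hsum : β - N * h = (a i * x i - e i) + ∑ j ∈ Finset.range n \ {i}, (a j * x j - e j) := by
    rw [add_comm, Finset.sum_sdiff_eq_sub (by simpa using hi), Finset.sum_singleton,
      sub_add_cancel, Finset.sum_sub_distrib, hβ, hN, Nat.cast_sum, Finset.sum_mul]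
  have hmain : Admissible p (c i) (δ i) (x i) ↔ ValGe p g (β - N * h) := by
    rw [hsum, ValGe.add_iff_left (ValGe.sum hterm), he' i hai rfl]
    exact admissible_iff_valGe (hδ i) (hc i hi hai).1 hai (x i)
  rw [hmain]
  by_cases hp2 : p = 2
  · subst hp2
    -- As `2 * h = 2 ^ g`, only the parity of `N` matters modulo `2 ^ g`.
    have h2h : ValGe 2 g (2 * h) := by
      have : 2 * h = ((2 : ℕ) : ℚ) ^ g := by
        rw [hh, zpow_sub_one₀ (by norm_num)]; push_cast; ring
      rw [this]; exact valEq_zpow.valGe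
    have hmul : ∀ k : ℕ, ValGe 2 g (k * (2 * h)) := by
      intro k
      rw [← nsmul_eq_mul, ← Finset.card_range k, ← Finset.sum_const]
      exact ValGe.sum fun _ _ => h2h
    split_ifs with hodd
    · obtain ⟨k, hk⟩ := hodd
      have : β - N * h = (β - h) + -(k * (2 * h)) := by rw [hk]; push_cast; ring
      rw [this, ValGe.add_iff_left (hmul k).neg, valEq_two_iff, hh]
      push_cast
      exact Iff.rfl
    · obtain ⟨k, hk⟩ := Nat.not_odd_iff_even.mp hodd
      have : β - N * h = β + -(k * (2 * h)) := by rw [hk]; push_cast; ring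
      rw [this, ValGe.add_iff_left (hmul k).neg]
  · have hN0 : N = 0 := by
      refine Finset.sum_eq_zero fun j _ => ?_
      have : δ j = false := by
        by_contra hj
        exact hp2 (hδ j (by simpa using hj))
      simp [this]
    simp only [hN0, Nat.not_odd_zero, if_false, Nat.cast_zero, zero_mul, sub_zero]
    exact Iff.rfl

/-! # Fraction-free elimination -/

section Bareiss

open Matrix

variable {R : Type*} {ι : Type} [Fintype ι] [DecidableEq ι]

/-- The matrix with rows `r` and `i` and columns `c` and `j` of `M`. -/
def bordered (M : Matrix ℕ ℕ R) (r c : ι → ℕ) (i j : ℕ) : Matrix (ι ⊕ Unit) (ι ⊕ Unit) R :=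
  M.submatrix (Sum.elim r fun _ => i) (Sum.elim c fun _ => j)

/-- Determinant of a block matrix by the Schur complement. The complement is formed in all of `M`,
so that one and the same matrix serves every choice of additional rows and columns. -/
theorem det_submatrix_sumElim {F : Type*} [Field F] (M : Matrix ℕ ℕ F) {κ : Type} [Fintype κ]
    [DecidableEq κ] {r c : ι → ℕ} (h : (M.submatrix r c).det ≠ 0) (r' c' : κ → ℕ) :
    (M.submatrix (Sum.elim r r') (Sum.elim c c')).det = (M.submatrix r c).det *
      ((M - M.submatrix id c * (M.submatrix r c)⁻¹ * M.submatrix r id).submatrix r' c').det := by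
  have : Invertible (M.submatrix r c) := Matrix.invertibleOfIsUnitDet _ (isUnit_iff_ne_zero.mpr h)
  have h1 : M.submatrix (Sum.elim r r') (Sum.elim c c') =
      fromBlocks (M.submatrix r c) (M.submatrix r c') (M.submatrix r' c) (M.submatrix r' c') := by
    ext i j
    rcases i with i | i <;> rcases j with j | j <;> rfl
  rw [h1, det_fromBlocks₁₁, invOf_eq_nonsing_inv]
  congr 2

/-- The identity of Sylvester for minors with two additional rows and columns. -/
theorem det_mul_det_bordered_bordered {F : Type*} [Field F] (M : Matrix ℕ ℕ F) {r c : ι → ℕ}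
    (h : (M.submatrix r c).det ≠ 0) (i₁ j₁ i₂ j₂ : ℕ) :
    (M.submatrix r c).det *
        (bordered M (Sum.elim r fun _ : Unit => i₁) (Sum.elim c fun _ : Unit => j₁) i₂ j₂).det =
      (bordered M r c i₁ j₁).det * (bordered M r c i₂ j₂).det -
        (bordered M r c i₂ j₁).det * (bordered M r c i₁ j₂).det := by
  -- Up to the factor `det`, bordered minors are entries of `S`, and doubly bordered ones are `2 ×
  -- 2` minors of `S`; the identity is the formula for a `2 × 2` determinant.
  set S := M - M.submatrix id c * (M.submatrix r c)⁻¹ * M.submatrix r id with hS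
  have h1 : ∀ i j, (bordered M r c i j).det = (M.submatrix r c).det * S i j := by
    intro i j
    rw [bordered, det_submatrix_sumElim M h]
    congr 1
    exact det_unique _
  have h2 : (bordered M (Sum.elim r fun _ : Unit => i₁) (Sum.elim c fun _ : Unit => j₁) i₂ j₂).det
      = (M.submatrix r c).det * (S i₁ j₁ * S i₂ j₂ - S i₁ j₂ * S i₂ j₁) := by
    have h3 := det_submatrix_sumElim M h ![i₁, i₂] ![j₁, j₂]
    rw [← hS, det_fin_two] at h3
    simp only [submatrix_apply, cons_val_zero, cons_val_one] at h3
    rw [← h3]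
    -- Adding two rows at once and adding them one after the other differ only by this reindexing,
    -- the same for rows and columns.
    set e : ι ⊕ Fin 2 ≃ (ι ⊕ Unit) ⊕ Unit :=
      ((Equiv.refl ι).sumCongr (finTwoEquiv.trans Equiv.boolEquivPUnitSumPUnit)).trans
        (Equiv.sumAssoc ι Unit Unit).symm with he
    rw [← det_submatrix_equiv_self e]
    congr 1
    ext a b
    rcases a with a | a <;> rcases b with b | b
    · rfl
    · fin_cases b <;> rfl
    · fin_cases a <;> rfl
    · fin_cases a <;> fin_cases b <;> rfl
  rw [h2, h1, h1, h1, h1]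
  ring

theorem det_mul_det_bordered_bordered_int (M : Matrix ℕ ℕ ℤ) {r c : ι → ℕ}
    (h : (M.submatrix r c).det ≠ 0) (i₁ j₁ i₂ j₂ : ℕ) :
    (M.submatrix r c).det *
        (bordered M (Sum.elim r fun _ : Unit => i₁) (Sum.elim c fun _ : Unit => j₁) i₂ j₂).det =
      (bordered M r c i₁ j₁).det * (bordered M r c i₂ j₂).det -
        (bordered M r c i₂ j₁).det * (bordered M r c i₁ j₂).det := by
  have hdet : ∀ {κ : Type} [Fintype κ] [DecidableEq κ] (u v : κ → ℕ),
      ((M.map (Int.cast : ℤ → ℚ)).submatrix u v).det = ((M.submatrix u v).det : ℚ) := by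
    intro κ _ _ u v
    rw [Int.cast_det]
    rfl
  have h1 := det_mul_det_bordered_bordered (M.map (Int.cast : ℤ → ℚ)) (r := r) (c := c)
    (by rw [hdet]; exact_mod_cast h) i₁ j₁ i₂ j₂
  unfold bordered at h1 ⊢
  simp only [hdet] at h1
  exact_mod_cast h1

/-- Before row `k` of an `m × (n + 1)` matrix `M` is treated by fraction-free elimination, the last
pivot is `d`, and the entries of the matrix `W` in the remaining rows are minors of `M` that extend
a minor of value `d`. -/
def Bareiss (M : Matrix ℕ ℕ ℤ) (m n k : ℕ) (d : ℤ) (W : ℕ → ℕ → ℤ) : Prop :=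
  ∃ (ι : Type) (_ : Fintype ι) (_ : DecidableEq ι) (r c : ι → ℕ), Fintype.card ι ≤ k ∧
    (∀ t, r t < m ∧ c t ≤ n) ∧ (M.submatrix r c).det = d ∧ d ≠ 0 ∧
    ∀ i j, k ≤ i → i < m → j ≤ n → W i j = (bordered M r c i j).det

variable {M : Matrix ℕ ℕ ℤ} {m n k : ℕ} {d : ℤ} {W W' : ℕ → ℕ → ℤ}

/-- The initial minor is the empty one, of value `1`; bordering it gives the entries of `M`. -/
theorem bareiss_zero (hW : ∀ i j, i < m → j ≤ n → W i j = M i j) : Bareiss M m n 0 1 W := by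
  refine ⟨Empty, inferInstance, inferInstance, Empty.elim, Empty.elim, by simp,
    fun t => t.elim, by simp, one_ne_zero, fun i j _ hi hj => ?_⟩
  rw [hW i j hi hj, bordered, ← det_submatrix_equiv_self (Equiv.emptySum Empty Unit).symm,
    det_unique]
  rfl

/-- For a row without pivot: the minor does not grow, which is why `Bareiss` only asks its size to
be at most `k`. -/
theorem Bareiss.succ (h : Bareiss M m n k d W) : Bareiss M m n (k + 1) d W := by
  obtain ⟨ι, _, _, r, c, hcard, hrc, hd, hd0, hW⟩ := h
  exact ⟨ι, _, _, r, c, by omega, hrc, hd, hd0, fun i j hk => hW i j (by omega)⟩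

theorem Bareiss.congr (h : Bareiss M m n k d W)
    (hW : ∀ i j, k ≤ i → i < m → j ≤ n → W' i j = W i j) : Bareiss M m n k d W' := by
  obtain ⟨ι, _, _, r, c, hcard, hrc, hd, hd0, hW'⟩ := h
  exact ⟨ι, _, _, r, c, hcard, hrc, hd, hd0,
    fun i j hk hi hj => (hW i j hk hi hj).trans (hW' i j hk hi hj)⟩

theorem Bareiss.ne_zero (h : Bareiss M m n k d W) : d ≠ 0 := by
  obtain ⟨ι, _, _, r, c, hcard, hrc, hd, hd0, hW⟩ := h
  exact hd0

/-- One elimination step with pivot in row `k` and column `q`. -/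
def eliminate (W : ℕ → ℕ → ℤ) (k q : ℕ) (d : ℤ) (i j : ℕ) : ℤ :=
  (W k q * W i j - W i q * W k j) / d

/-- The division in `eliminate` is exact, since by Sylvester's identity the numerator is `d` times a
doubly bordered minor. -/
theorem Bareiss.mul_eliminate (h : Bareiss M m n k d W) {q : ℕ} (hq : q ≤ n) {i j : ℕ}
    (hki : k ≤ i) (hi : i < m) (hj : j ≤ n) :
    d * eliminate W k q d i j = W k q * W i j - W i q * W k j := by
  obtain ⟨ι, _, _, r, c, hcard, hrc, hd, hd0, hW⟩ := h
  have h1 := det_mul_det_bordered_bordered_int M (r := r) (c := c) (by rwa [hd]) k q i j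
  rw [hd, ← hW k q le_rfl (by omega) hq, ← hW i j hki hi hj, ← hW i q hki hi hq,
    ← hW k j le_rfl (by omega) hj] at h1
  exact Int.mul_ediv_cancel' ⟨_, h1.symm⟩

/-- The minor grows by row `k` and column `q`, and its value becomes the pivot. The new entries are
Sylvester's identity with `d` cancelled. -/
theorem Bareiss.step (h : Bareiss M m n k d W) (hk : k < m) {q : ℕ} (hq : q ≤ n)
    (hp : W k q ≠ 0) : Bareiss M m n (k + 1) (W k q) (eliminate W k q d) := by
  have h0 := h
  obtain ⟨ι, _, _, r, c, hcard, hrc, hd, hd0, hW⟩ := h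
  refine ⟨ι ⊕ Unit, inferInstance, inferInstance, Sum.elim r fun _ => k, Sum.elim c fun _ => q,
    by simpa using hcard, ?_, (hW k q le_rfl hk hq).symm, hp, fun i j hki hi hj => ?_⟩
  · rintro (t | t)
    exacts [hrc t, ⟨hk, hq⟩]
  · refine mul_left_cancel₀ hd0 ?_
    rw [h0.mul_eliminate hq (by omega) hi hj, hW k q le_rfl hk hq, hW i j (by omega) hi hj,
      hW i q (by omega) hi hq, hW k j le_rfl hk hj,
      ← det_mul_det_bordered_bordered_int M (by rwa [hd]), hd]

theorem abs_det_submatrix_le {κ : Type} [Fintype κ] [DecidableEq κ] {X : ℤ} {l : ℕ} (hX : 1 ≤ X)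
    (hM : ∀ i j, i < m → j ≤ n → |M i j| ≤ X) (r c : κ → ℕ) (hrc : ∀ t, r t < m ∧ c t ≤ n)
    (hl : Fintype.card κ ≤ l) : |(M.submatrix r c).det| ≤ l.factorial * X ^ l := by
  have h := Matrix.det_le (A := M.submatrix r c) (abv := AbsoluteValue.abs) (x := X)
    (fun i j => hM _ _ (hrc i).1 (hrc j).2)
  rw [nsmul_eq_mul] at h
  refine h.trans ?_
  exact mul_le_mul (by exact_mod_cast Nat.factorial_le hl) (pow_le_pow_right₀ hX hl)
    (by positivity) (by positivity)

/-- An entry is a minor of size at most `k + 1`, so the Leibniz formula applies. -/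
theorem Bareiss.abs_entry_le (h : Bareiss M m n k d W) {X : ℤ} {l : ℕ} (hX : 1 ≤ X)
    (hM : ∀ i j, i < m → j ≤ n → |M i j| ≤ X) (hkl : k + 1 ≤ l) {i j : ℕ} (hki : k ≤ i)
    (hi : i < m) (hj : j ≤ n) : |W i j| ≤ l.factorial * X ^ l := by
  obtain ⟨ι, _, _, r, c, hcard, hrc, hd, hd0, hW⟩ := h
  rw [hW i j hki hi hj]
  refine abs_det_submatrix_le hX hM _ _ ?_ (by simp; omega)
  rintro (t | t)
  exacts [hrc t, ⟨hi, hj⟩]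

end Bareiss

/-! # Solutions of the remaining equations -/

/-- The rows from `k` on have a common solution with admissible entries. -/
def RowsSolvable (p m n : ℕ) (c : ℕ → WithBot ℤ) (δ : ℕ → Bool) (k : ℕ) (W : ℕ → ℕ → ℤ) : Prop :=
  ∃ x : ℕ → ℚ, (∀ j < n, Admissible p (c j) (δ j) (x j)) ∧
    ∀ i, k ≤ i → i < m → ∑ j ∈ Finset.range n, (W i j : ℚ) * x j = W i n

section RowsSolvable

variable {p m n k : ℕ} {c : ℕ → WithBot ℤ} {δ : ℕ → Bool} {W W' : ℕ → ℕ → ℤ}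

theorem RowsSolvable.congr (h : RowsSolvable p m n c δ k W)
    (hW : ∀ i j, k ≤ i → i < m → j ≤ n → W' i j = W i j) : RowsSolvable p m n c δ k W' := by
  obtain ⟨x, hx, h⟩ := h
  refine ⟨x, hx, fun i hk hi => ?_⟩
  rw [hW i n hk hi le_rfl, ← h i hk hi]
  exact Finset.sum_congr rfl fun j hj => by rw [hW i j hk hi (Finset.mem_range.mp hj).le]

theorem rowsSolvable_congr (hW : ∀ i j, k ≤ i → i < m → j ≤ n → W' i j = W i j) :
    RowsSolvable p m n c δ k W' ↔ RowsSolvable p m n c δ k W :=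
  ⟨fun h => h.congr fun i j hk hi hj => (hW i j hk hi hj).symm, fun h => h.congr hW⟩

theorem rowsSolvable_self [Fact p.Prime] : RowsSolvable p m n c δ m W := by
  choose x hx using fun j => exists_admissible (p := p) (c j) (δ j)
  exact ⟨x, fun j _ => hx j, fun i h1 h2 => absurd h1 (by omega)⟩

theorem rowsSolvable_iff_of_zero (hk : k < m) (h0 : ∀ j < n, W k j = 0) :
    RowsSolvable p m n c δ k W ↔ W k n = 0 ∧ RowsSolvable p m n c δ (k + 1) W := by
  have hsum : ∀ x : ℕ → ℚ, ∑ j ∈ Finset.range n, (W k j : ℚ) * x j = 0 := fun x =>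
    Finset.sum_eq_zero fun j hj => by rw [h0 j (Finset.mem_range.mp hj)]; simp
  constructor
  · rintro ⟨x, hx, h⟩
    refine ⟨?_, x, hx, fun i hi => h i (by omega)⟩
    have := h k le_rfl hk
    rw [hsum] at this
    exact_mod_cast this.symm
  · rintro ⟨hn, x, hx, h⟩
    refine ⟨x, hx, fun i hki hi => ?_⟩
    rcases hki.eq_or_lt with rfl | hlt
    · rw [hsum, hn]; simp
    · exact h i hlt hi

/-- Elimination of a variable whose admissibility is, by row `k`, equivalent to `T`. -/
theorem rowsSolvable_iff_of_pivot (hk : k < m) {q : ℕ} (hq : q < n) (hp : W k q ≠ 0) {d : ℤ}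
    (hd : d ≠ 0) (hW' : ∀ i j, k < i → i < m → j ≤ n →
      d * W' i j = W k q * W i j - W i q * W k j) {T : Prop}
    (hT : ∀ x : ℕ → ℚ, (∀ j < n, j ≠ q → Admissible p (c j) (δ j) (x j)) →
      ∑ j ∈ Finset.range n, (W k j : ℚ) * x j = W k n → (Admissible p (c q) (δ q) (x q) ↔ T)) :
    RowsSolvable p m n c δ k W ↔ T ∧ RowsSolvable p m n c δ (k + 1) W' := by
  have hp' : (W k q : ℚ) ≠ 0 := by exact_mod_cast hp
  have hd' : (d : ℚ) ≠ 0 := by exact_mod_cast hd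
  -- The defect of a new row is a combination of the defects of the old row and of row `k`.
  have hlin : ∀ (x : ℕ → ℚ) i, k < i → i < m →
      (d : ℚ) * (∑ j ∈ Finset.range n, (W' i j : ℚ) * x j - W' i n) =
        W k q * (∑ j ∈ Finset.range n, (W i j : ℚ) * x j - W i n) -
          W i q * (∑ j ∈ Finset.range n, (W k j : ℚ) * x j - W k n) := by
    intro x i hki hi
    have hcast : ∀ j ≤ n, (d : ℚ) * W' i j = W k q * W i j - W i q * W k j := fun j hj => by
      exact_mod_cast hW' i j hki hi hj
    have : (d : ℚ) * ∑ j ∈ Finset.range n, (W' i j : ℚ) * x j =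
        W k q * ∑ j ∈ Finset.range n, (W i j : ℚ) * x j -
          W i q * ∑ j ∈ Finset.range n, (W k j : ℚ) * x j := by
      rw [Finset.mul_sum, Finset.mul_sum, Finset.mul_sum, ← Finset.sum_sub_distrib]
      refine Finset.sum_congr rfl fun j hj => ?_
      rw [← mul_assoc, hcast j (Finset.mem_range.mp hj).le]
      ring
    rw [mul_sub, this, hcast n le_rfl]
    ring
  constructor
  · rintro ⟨x, hx, h⟩
    refine ⟨(hT x (fun j hj _ => hx j hj) (h k le_rfl hk)).mp (hx q hq), x, hx,
      fun i hki hi => ?_⟩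
    have := hlin x i hki hi
    rw [h k le_rfl hk, h i (by omega) hi, sub_self, sub_self, mul_zero, mul_zero, sub_zero] at this
    exact sub_eq_zero.mp ((mul_eq_zero.mp this).resolve_left hd')
  · rintro ⟨hT', x, hx, h⟩
    -- Coordinate `q` is chosen so that row `k` holds. The new rows do not notice the change, as
    -- their entries in column `q` vanish.
    set y := Function.update x q
      ((W k n - ∑ j ∈ Finset.range n \ {q}, (W k j : ℚ) * x j) / W k q) with hy
    have hyx : ∀ j, j ≠ q → y j = x j := fun j hj => Function.update_of_ne hj _ _
    have hrow : ∑ j ∈ Finset.range n, (W k j : ℚ) * y j = W k n := by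
      have hq' : {q} ⊆ Finset.range n := by simpa using hq
      rw [← Finset.sum_sdiff hq', Finset.sum_singleton]
      have : ∑ j ∈ Finset.range n \ {q}, (W k j : ℚ) * y j =
          ∑ j ∈ Finset.range n \ {q}, (W k j : ℚ) * x j :=
        Finset.sum_congr rfl fun j hj => by
          rw [hyx j (by simpa using (Finset.mem_sdiff.mp hj).2)]
      rw [this, hy, Function.update_self]
      field_simp
      ring
    have hy' : ∀ j < n, j ≠ q → Admissible p (c j) (δ j) (y j) := fun j hj hjq => by
      rw [hyx j hjq]; exact hx j hj
    refine ⟨y, fun j hj => ?_, fun i hki hi => ?_⟩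
    · by_cases hjq : j = q
      · subst hjq; exact (hT y hy' hrow).mpr hT'
      · exact hy' j hj hjq
    · rcases hki.eq_or_lt with rfl | hlt
      · exact hrow
      · have h1 := hlin y i hlt hi
        have hq0 : W' i q = 0 := by
          have := hW' i q hlt hi hq.le
          rw [mul_comm (W i q), sub_self] at this
          exact (mul_eq_zero.mp this).resolve_left hd
        have h2 : ∑ j ∈ Finset.range n, (W' i j : ℚ) * y j = W' i n := by
          rw [← h i hlt hi]
          refine Finset.sum_congr rfl fun j _ => ?_
          by_cases hjq : j = q
          · subst hjq; rw [hq0]; simp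
          · rw [hyx j hjq]
        rw [h2, hrow, sub_self, sub_self, mul_zero, mul_zero, sub_zero] at h1
        exact sub_eq_zero.mp ((mul_eq_zero.mp h1.symm).resolve_left hp')

end RowsSolvable

/-! # The input word -/

theorem List.getD_append_add {α : Type*} {l l' : List α} {a : ℕ} (h : l.length = a) (k : ℕ)
    (d : α) : (l ++ l').getD (a + k) d = l'.getD k d := by
  rw [List.getD_append_right _ _ _ _ (by omega)]
  congr 1
  omega

theorem List.length_flatten_ofFn {α : Type*} {n l : ℕ} {f : Fin n → List α}
    (h : ∀ i, (f i).length = l) : (List.ofFn f).flatten.length = n * l := by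
  simp [List.length_flatten, List.map_ofFn, Function.comp_def, h]

theorem List.getD_flatten_ofFn {α : Type*} {n l : ℕ} {f : Fin n → List α}
    (h : ∀ i, (f i).length = l) (i : Fin n) {r : ℕ} (hr : r < l) (d : α) :
    (List.ofFn f).flatten.getD (i * l + r) d = (f i).getD r d := by
  induction n with
  | zero => exact i.elim0
  | succ n ih =>
    rw [List.ofFn_succ, List.flatten_cons]
    refine Fin.cases ?_ (fun i => ?_) i
    · rw [List.getD_append _ _ _ _ (by rw [h]; simpa using hr)]
      simp
    · rw [← ih (f := fun i => f i.succ) (fun i => h _) i,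
        ← List.getD_append_add (l' := (List.ofFn fun i => f i.succ).flatten) (h 0)]
      congr 1
      simp only [Fin.val_succ]
      ring

namespace ValuedSystem

variable (S : ValuedSystem)

/-- The lower bounds, as a function on all natural numbers. -/
def bound (j : ℕ) : WithBot ℤ := if h : j < S.n then S.c ⟨j, h⟩ else ⊥

/-- The flags `δ`, as a function on all natural numbers. -/
def flag (j : ℕ) : Bool := if h : j < S.n then S.δ ⟨j, h⟩ else false

/-- Variable `j` has a prescribed valuation. -/
def exact (j : ℕ) : Bool := S.flag j && decide (S.p = 2)

/-- The augmented matrix, as a function on all pairs of natural numbers. -/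
def augmented (i j : ℕ) : ℚ :=
  if hi : i < S.m then if hj : j < S.n then S.A ⟨i, hi⟩ ⟨j, hj⟩ else S.b ⟨i, hi⟩ else 0

/-- A common denominator of row `i`. -/
def denominator (i : ℕ) : ℕ := ∏ j ∈ Finset.range (S.n + 1), (S.augmented i j).den

/-- The augmented matrix with row `i` multiplied by `S.denominator i`. -/
def integral (i j : ℕ) : ℤ :=
  (S.augmented i j).num * (S.denominator i / (S.augmented i j).den : ℤ)

variable {S}

theorem exact_eq_true {j : ℕ} (h : S.exact j = true) : S.p = 2 := by
  simp only [exact, Bool.and_eq_true, decide_eq_true_eq] at h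
  exact h.2

theorem augmented_of_lt {i j : ℕ} (hi : i < S.m) (hj : j < S.n) :
    S.augmented i j = S.A ⟨i, hi⟩ ⟨j, hj⟩ := by
  simp [augmented, hi, hj]

theorem augmented_n {i : ℕ} (hi : i < S.m) : S.augmented i S.n = S.b ⟨i, hi⟩ := by
  simp [augmented, hi]

/-! ### Addresses in the input word -/

section Encode

theorem length_encodeBound (c : WithBot ℤ) : (encodeBound c).length = 2 := by
  cases c <;> rfl

theorem encodeBound_getD_zero (c : WithBot ℤ) :
    (encodeBound c).getD 0 0 = if c = ⊥ then 0 else 1 := by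
  cases c <;> rfl

theorem encodeBound_getD_one (c : WithBot ℤ) : (encodeBound c).getD 1 0 = c.unbotD 0 := by
  cases c <;> rfl

theorem length_encodeRat (q : ℚ) : (encodeRat q).length = 2 := rfl

theorem length_encodeRow (i : Fin S.m) :
    (List.ofFn fun j => encodeRat (S.A i j)).flatten.length = S.n * 2 :=
  List.length_flatten_ofFn fun _ => rfl

theorem length_encode_bounds :
    (List.ofFn fun j => encodeBound (S.c j)).flatten.length = S.n * 2 :=
  List.length_flatten_ofFn fun _ => length_encodeBound _

theorem length_encode_matrix :
    (List.ofFn fun i => (List.ofFn fun j => encodeRat (S.A i j)).flatten).flatten.length =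
      S.m * (S.n * 2) :=
  List.length_flatten_ofFn length_encodeRow

/-- Layout of the word: `3` header cells, `2 * n` cells for the bounds, `n` for the flags, `2 * m *
n` for the matrix and `2 * m` for the right-hand side. The following lemmas locate the items. -/
theorem encode_bounds {k : ℕ} (hk : k < S.n * 2) : S.encode.getD (3 + k) 0 =
    (List.ofFn fun j => encodeBound (S.c j)).flatten.getD k 0 := by
  rw [encode, List.append_assoc, List.append_assoc, List.append_assoc,
    List.getD_append_add (by rfl), List.getD_append _ _ _ _ (by rwa [length_encode_bounds])]

theorem encode_bound_zero {j : ℕ} (hj : j < S.n) :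
    S.encode.getD (3 + 2 * j) 0 = if S.bound j = ⊥ then 0 else 1 := by
  rw [encode_bounds (by omega), mul_comm, ← add_zero (j * 2),
    List.getD_flatten_ofFn (fun _ => length_encodeBound _) ⟨j, hj⟩ (by norm_num),
    encodeBound_getD_zero]
  simp [bound, hj]

theorem encode_bound_one {j : ℕ} (hj : j < S.n) :
    S.encode.getD (3 + 2 * j + 1) 0 = (S.bound j).unbotD 0 := by
  rw [add_assoc, encode_bounds (by omega), mul_comm,
    List.getD_flatten_ofFn (fun _ => length_encodeBound _) ⟨j, hj⟩ (by norm_num),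
    encodeBound_getD_one]
  simp [bound, hj]

theorem encode_flag {j : ℕ} (hj : j < S.n) :
    S.encode.getD (3 + 2 * S.n + j) 0 = (S.flag j).toNat := by
  have h : (List.ofFn fun j => if S.δ j then (1 : ℤ) else 0).getD j 0 = (S.flag j).toNat := by
    rw [List.getD_eq_getElem _ _ (by simpa using hj), List.getElem_ofFn]
    simp only [flag, hj, dif_pos]
    cases S.δ ⟨j, hj⟩ <;> rfl
  rw [encode, List.append_assoc, List.append_assoc, List.append_assoc, add_assoc,
    List.getD_append_add (by rfl), List.getD_append_add (by rw [length_encode_bounds, mul_comm]),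
    List.getD_append _ _ _ _ (by simpa using hj), h]

theorem encode_matrix_getD {k : ℕ} (hk : k < S.m * (S.n * 2)) :
    S.encode.getD (3 + 3 * S.n + k) 0 =
      (List.ofFn fun i => (List.ofFn fun j => encodeRat (S.A i j)).flatten).flatten.getD k 0 := by
  rw [encode, List.append_assoc, List.append_assoc, List.append_assoc,
    show 3 + 3 * S.n + k = 3 + (S.n * 2 + (S.n + k)) by ring,
    List.getD_append_add (by rfl), List.getD_append_add length_encode_bounds,
    List.getD_append_add (by simp), List.getD_append _ _ _ _ (by rwa [length_encode_matrix])]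

theorem encode_matrix {i j r : ℕ} (hi : i < S.m) (hj : j < S.n) (hr : r < 2) :
    S.encode.getD (3 + 3 * S.n + (i * (S.n * 2) + (j * 2 + r))) 0 =
      (encodeRat (S.augmented i j)).getD r 0 := by
  have h1 : j * 2 + r < S.n * 2 := by omega
  rw [encode_matrix_getD, List.getD_flatten_ofFn length_encodeRow ⟨i, hi⟩ h1,
    List.getD_flatten_ofFn (fun _ => length_encodeRat _) ⟨j, hj⟩ hr, augmented_of_lt hi hj]
  nlinarith

theorem encode_rhs {i r : ℕ} (hi : i < S.m) (hr : r < 2) :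
    S.encode.getD (3 + 3 * S.n + (S.m * (S.n * 2) + (i * 2 + r))) 0 =
      (encodeRat (S.augmented i S.n)).getD r 0 := by
  rw [encode, List.append_assoc, List.append_assoc, List.append_assoc,
    show 3 + 3 * S.n + (S.m * (S.n * 2) + (i * 2 + r)) =
      3 + (S.n * 2 + (S.n + (S.m * (S.n * 2) + (i * 2 + r)))) by ring,
    List.getD_append_add (by rfl), List.getD_append_add length_encode_bounds,
    List.getD_append_add (by simp), List.getD_append_add length_encode_matrix,
    List.getD_flatten_ofFn (fun _ => length_encodeRat _) ⟨i, hi⟩ hr, augmented_n hi]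

end Encode

/-! # Solvability in terms of the integral matrix -/

theorem coe_le_ratVal {p : ℕ} {k : ℤ} {x : ℚ} :
    (k : WithTop ℤ) ≤ ratVal p x ↔ ValGe p k x := by
  unfold ratVal ValGe
  split_ifs with h
  · simp [h]
  · simp [h, WithTop.coe_le_coe]

theorem ratVal_eq_coe {p : ℕ} {k : ℤ} {x : ℚ} :
    ratVal p x = (k : WithTop ℤ) ↔ ValEq p k x := by
  unfold ratVal ValEq
  split_ifs with h
  · simp [h]
  · simp [h, WithTop.coe_inj]

theorem denominator_pos (i : ℕ) : 0 < S.denominator i :=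
  Finset.prod_pos fun _ _ => Rat.den_pos _

theorem den_dvd_denominator {i j : ℕ} (hj : j ≤ S.n) :
    (S.augmented i j).den ∣ S.denominator i :=
  Finset.dvd_prod_of_mem (fun j => (S.augmented i j).den) (by simpa [Nat.lt_succ_iff] using hj)

theorem integral_cast {i j : ℕ} (hj : j ≤ S.n) :
    (S.integral i j : ℚ) = S.denominator i * S.augmented i j := by
  have h0 : ((S.augmented i j).den : ℚ) ≠ 0 := by exact_mod_cast (S.augmented i j).den_nz
  obtain ⟨e, he⟩ := den_dvd_denominator (i := i) hj
  have h1 : ((S.denominator i : ℤ) / ((S.augmented i j).den : ℤ)) = e := by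
    rw [he]
    push_cast
    exact Int.mul_ediv_cancel_left _ (by exact_mod_cast (S.augmented i j).den_nz)
  rw [integral, h1, he]
  nth_rewrite 3 [← Rat.num_div_den (S.augmented i j)]
  push_cast
  field_simp

theorem admissible_bound_iff {j : ℕ} (hj : j < S.n) (y : ℚ) :
    Admissible S.p (S.bound j) (S.exact j) y ↔
      (∀ k : ℤ, S.c ⟨j, hj⟩ = k → ValGe S.p k y) ∧
        (S.p = 2 → ∀ k : ℤ, S.δ ⟨j, hj⟩ = true → S.c ⟨j, hj⟩ = k → ValEq S.p k y) := by
  simp only [Admissible, bound, exact, flag, hj, dif_pos, Bool.and_eq_true, decide_eq_true_eq]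
  constructor
  · intro h
    refine ⟨fun k hk => ?_, fun hp k hδ hk => by simpa [hδ, hp] using h k hk⟩
    have := h k hk
    split_ifs at this
    exacts [this.valGe, this]
  · rintro ⟨h1, h2⟩ k hk
    split_ifs with h
    exacts [h2 h.2 k h.1 hk, h1 k hk]

/-- Row `i` has been multiplied by a nonzero common denominator, and coordinates of index at least
`n` are irrelevant. -/
theorem solvable_iff : S.Solvable ↔ RowsSolvable S.p S.m S.n S.bound S.exact 0 S.integral := by
  have hrow : ∀ (x : ℕ → ℚ) (i : Fin S.m),
      ∑ j ∈ Finset.range S.n, (S.integral i j : ℚ) * x j = S.integral i S.n ↔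
        S.A.mulVec (fun j => x j) i = S.b i := by
    intro x i
    have hd : (S.denominator i : ℚ) ≠ 0 := by exact_mod_cast (denominator_pos (S := S) i).ne'
    have h1 : ∑ j ∈ Finset.range S.n, (S.integral i j : ℚ) * x j =
        S.denominator i * S.A.mulVec (fun j => x j) i := by
      rw [Matrix.mulVec, dotProduct, Finset.mul_sum, ← Fin.sum_univ_eq_sum_range
        (fun j => (S.integral i j : ℚ) * x j)]
      refine Finset.sum_congr rfl fun j _ => ?_
      rw [integral_cast j.2.le, augmented_of_lt i.2 j.2, mul_assoc]
    rw [h1, integral_cast le_rfl, augmented_n i.2, mul_right_inj' hd]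
  constructor
  · rintro ⟨x, hA, hge, heq⟩
    set y : ℕ → ℚ := fun j => if h : j < S.n then x ⟨j, h⟩ else 0 with hy
    have hyx : (fun j : Fin S.n => y j) = x := by funext j; simp [hy]
    refine ⟨y, fun j hj => ?_, fun i _ hi => ?_⟩
    · rw [admissible_bound_iff hj]
      have : y j = x ⟨j, hj⟩ := by simp [hy, hj]
      rw [this]
      exact ⟨fun k hk => coe_le_ratVal.mp (hge _ k hk),
        fun hp k hδ hk => ratVal_eq_coe.mp (heq hp _ k hδ hk)⟩
    · exact (hrow y ⟨i, hi⟩).mpr (by rw [hyx, hA])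
  · rintro ⟨y, hy, hrows⟩
    refine ⟨fun j => y j, ?_, fun j k hk => ?_, fun hp j k hδ hk => ?_⟩
    · funext i
      exact (hrow y i).mp (hrows i (Nat.zero_le _) i.2)
    · exact coe_le_ratVal.mpr (((admissible_bound_iff j.2 _).mp (hy j j.2)).1 k hk)
    · exact ratVal_eq_coe.mpr (((admissible_bound_iff j.2 _).mp (hy j j.2)).2 hp k hδ hk)

/-! # Bounds in terms of the input size -/

theorem num_lt (q : ℚ) : q.num.natAbs < 2 ^ height q :=
  (Nat.lt_pow_succ_log_self one_lt_two _).trans_le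
    (Nat.pow_le_pow_right two_pos (by unfold height; omega))

theorem den_lt (q : ℚ) : q.den < 2 ^ height q :=
  (Nat.lt_pow_succ_log_self one_lt_two _).trans_le
    (Nat.pow_le_pow_right two_pos (by unfold height; omega))

theorem abs_num_le {q : ℚ} {N : ℕ} (h : height q ≤ N) : |q.num| ≤ 2 ^ N := by
  rw [Int.abs_eq_natAbs]
  exact_mod_cast (num_lt q).le.trans (Nat.pow_le_pow_right two_pos h)

theorem den_le {q : ℚ} {N : ℕ} (h : height q ≤ N) : (q.den : ℤ) ≤ 2 ^ N := by
  exact_mod_cast (den_lt q).le.trans (Nat.pow_le_pow_right two_pos h)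

theorem one_le_size : 1 ≤ S.size := by unfold size; omega
theorem m_le_size : S.m ≤ S.size := by unfold size; omega
theorem n_le_size : S.n ≤ S.size := by unfold size; omega

theorem sum_height_row_le (i : Fin S.m) : ∑ j, height (S.A i j) + height (S.b i) ≤ S.size := by
  have h1 := Finset.single_le_sum (f := fun i => ∑ j, height (S.A i j))
    (fun _ _ => Nat.zero_le _) (Finset.mem_univ i)
  have h2 := Finset.single_le_sum (f := fun i => height (S.b i))
    (fun _ _ => Nat.zero_le _) (Finset.mem_univ i)
  simp only [size]
  beta_reduce at h1 h2
  omega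

theorem sum_height_augmented_le {i : ℕ} (hi : i < S.m) :
    ∑ j ∈ Finset.range (S.n + 1), height (S.augmented i j) ≤ S.size := by
  rw [Finset.sum_range_succ, augmented_n hi,
    ← Fin.sum_univ_eq_sum_range (fun j => height (S.augmented i j))]
  refine le_trans (le_of_eq ?_) (sum_height_row_le ⟨i, hi⟩)
  congr 1
  exact Finset.sum_congr rfl fun j _ => by rw [augmented_of_lt hi j.2]

theorem height_augmented_le {i j : ℕ} (hi : i < S.m) (hj : j ≤ S.n) :
    height (S.augmented i j) ≤ S.size :=
  (Finset.single_le_sum (f := fun j => height (S.augmented i j)) (fun _ _ => Nat.zero_le _)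
    (by simpa [Nat.lt_succ_iff] using hj)).trans (sum_height_augmented_le hi)

/-- Heights bound logarithms, and the heights in a row add up to at most the size. Partial products
are needed because the algorithm stores each of them. -/
theorem prod_den_le {i J : ℕ} (hi : i < S.m) (hJ : J ≤ S.n + 1) :
    ∏ j ∈ Finset.range J, (S.augmented i j).den ≤ 2 ^ S.size := by
  refine (Finset.prod_le_prod' fun j _ => (den_lt (S.augmented i j)).le).trans ?_
  rw [Finset.prod_pow_eq_pow_sum]
  refine Nat.pow_le_pow_right two_pos ((Finset.sum_le_sum_of_subset ?_).trans
    (sum_height_augmented_le hi))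
  exact Finset.range_subset_range.mpr hJ

theorem denominator_le {i : ℕ} (hi : i < S.m) : S.denominator i ≤ 2 ^ S.size :=
  prod_den_le hi le_rfl

theorem abs_integral_le {i j : ℕ} (hi : i < S.m) (hj : j ≤ S.n) :
    |S.integral i j| ≤ 2 ^ (2 * S.size) := by
  rw [integral, abs_mul, two_mul, pow_add]
  refine mul_le_mul (abs_num_le (height_augmented_le hi hj)) ?_ (abs_nonneg _) (by positivity)
  rw [abs_of_nonneg (by positivity)]
  have h1 : ((S.denominator i / (S.augmented i j).den : ℕ) : ℤ) ≤ (2 ^ S.size : ℕ) := by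
    exact_mod_cast (Nat.div_le_self _ _).trans (denominator_le hi)
  exact_mod_cast h1

theorem p_le : (S.p : ℤ) ≤ 2 ^ S.size := by
  have : height (S.p : ℚ) ≤ S.size := by unfold size; omega
  simpa using abs_num_le this

theorem abs_bound_le (j : Fin S.n) : |(S.c j).unbotD 0| ≤ 2 ^ S.size := by
  have h1 := Finset.single_le_sum (f := fun j => heightBound (S.c j))
    (fun _ _ => Nat.zero_le _) (Finset.mem_univ j)
  have h2 : heightBound (S.c j) ≤ S.size := by
    simp only [size]
    beta_reduce at h1
    omega
  cases hc : S.c j with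
  | bot => simp
  | coe k =>
    rw [hc] at h2
    simpa using abs_num_le (q := (k : ℚ)) h2

theorem abs_le_of_mem_encode {z : ℤ} (hz : z ∈ S.encode) : |z| ≤ 2 ^ S.size := by
  have h1 : (1 : ℤ) ≤ 2 ^ S.size := one_le_pow₀ one_le_two
  have hnat : ∀ k ≤ S.size, |(k : ℤ)| ≤ 2 ^ S.size := by
    intro k hk
    rw [abs_of_nonneg (by positivity)]
    exact_mod_cast hk.trans S.size.lt_two_pow_self.le
  have hrat : ∀ q : ℚ, height q ≤ S.size → z ∈ encodeRat q → |z| ≤ 2 ^ S.size := by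
    intro q hq hz
    simp only [encodeRat, List.mem_cons, List.not_mem_nil, or_false] at hz
    rcases hz with rfl | rfl
    · exact abs_num_le hq
    · rw [abs_of_nonneg (by positivity)]; exact den_le hq
  simp only [encode, List.mem_append, List.mem_cons, List.not_mem_nil, or_false, List.mem_flatten,
    List.mem_ofFn] at hz
  rcases hz with ((((rfl | rfl | rfl) | ⟨_, ⟨j, rfl⟩, hz⟩) | ⟨j, rfl⟩) | ⟨_, ⟨i, rfl⟩, hz⟩) |
    ⟨_, ⟨i, rfl⟩, hz⟩
  · exact hnat _ m_le_size
  · exact hnat _ n_le_size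
  · rw [abs_of_nonneg (by positivity)]; exact p_le
  · have h2 := abs_bound_le j
    cases hc : S.c j with
    | bot =>
      rw [hc] at hz
      have : z = 0 := by simpa [encodeBound] using hz
      subst this; simp
    | coe k =>
      rw [hc] at hz h2
      have : z = 1 ∨ z = k := by simpa [encodeBound] using hz
      rcases this with rfl | rfl
      · simpa using h1
      · simpa using h2
  · split_ifs
    · simpa using h1
    · simp
  · simp only [List.mem_flatten, List.mem_ofFn] at hz
    obtain ⟨_, ⟨j, rfl⟩, hz⟩ := hz
    refine hrat _ ?_ hz
    rw [← augmented_of_lt i.2 j.2]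
    exact height_augmented_le i.2 j.2.le
  · refine hrat _ ?_ hz
    rw [← augmented_n i.2]
    exact height_augmented_le i.2 le_rfl

end ValuedSystem

/-! # The algorithm -/

open BitRAM BitRAM.Cmd

local notation "rOk" => (0 : ℕ)
local notation "rM" => (1 : ℕ)
local notation "rN" => (2 : ℕ)
local notation "rP" => (3 : ℕ)
local notation "rTwo" => (4 : ℕ)
local notation "rRow" => (5 : ℕ)
local notation "rI" => (6 : ℕ)
local notation "rJ" => (7 : ℕ)
local notation "rDen" => (8 : ℕ)
local notation "rArg" => (9 : ℕ)
local notation "rVal" => (10 : ℕ)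
local notation "rFound" => (11 : ℕ)
local notation "rMin" => (12 : ℕ)
local notation "rCol" => (13 : ℕ)
local notation "rPar" => (14 : ℕ)
local notation "rShift" => (15 : ℕ)
local notation "rWeight" => (16 : ℕ)
local notation "rPiv" => (17 : ℕ)
local notation "rFac" => (18 : ℕ)

local infixr:60 " ;; " => Cmd.seq
local prefix:max "⌗" => Expr.var

namespace ValuedSystem

/-- Address of an entry of the working matrix, which is kept in array `1`. -/
def address (i j : Expr) : Expr := i * (⌗rN + 1) + j

/-- An entry of the working matrix. -/
def entry (i j : Expr) : Expr := .read 1 (address i j)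

/-- Part `r` (numerator or denominator) of a coefficient of the input. -/
def coeff (i j r : Expr) : Expr := .read 0 (3 + 3 * ⌗rN + (i * (⌗rN * 2) + (j * 2 + r)))

/-- Part `r` (numerator or denominator) of a right-hand side of the input. -/
def rhs (i r : Expr) : Expr := .read 0 (3 + 3 * ⌗rN + (⌗rM * (⌗rN * 2) + (i * 2 + r)))

/-- Computation of the valuation of a nonzero number. -/
def valuation : Cmd :=
  -- Tests are for positivity: `1 - x % p` is positive exactly when `p` divides `x`.
  .set rVal 0 ;; .loop (1 - ⌗rArg % ⌗rP) (.set rArg (⌗rArg / ⌗rP) ;; .set rVal (⌗rVal + 1))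

/-- Computation of the common denominator of a row. -/
def clearDen : Cmd :=
  .set rDen 1 ;; .set rJ 0 ;; forTo rJ ⌗rN (.set rDen (⌗rDen * coeff ⌗rI ⌗rJ 1)) ;;
    .set rDen (⌗rDen * rhs ⌗rI 1)

/-- One row of the integral matrix. -/
def clearRow : Cmd :=
  clearDen ;; .set rJ 0 ;;
    forTo rJ ⌗rN (.write 1 (address ⌗rI ⌗rJ) (coeff ⌗rI ⌗rJ 0 * (⌗rDen / coeff ⌗rI ⌗rJ 1))) ;;
    .write 1 (address ⌗rI ⌗rN) (rhs ⌗rI 0 * (⌗rDen / rhs ⌗rI 1))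

/-- Reading the dimensions and the prime. -/
def prologue : Cmd :=
  .set rM (.read 0 0) ;; .set rN (.read 0 1) ;; .set rP (.read 0 2) ;;
    .ite (3 - ⌗rP) (.set rTwo 1) (.set rTwo 0)

/-- Update of the minimal weight by a nonzero entry with finite bound. -/
def scanFinite : Cmd :=
  .set rShift (.read 0 (3 + 2 * ⌗rN + ⌗rJ) * ⌗rTwo) ;; valuation ;;
    .set rWeight (⌗rVal + .read 0 (3 + 2 * ⌗rJ + 1) + ⌗rShift) ;;
    -- Positive if nothing has been found (`rFound = 0`), or if there is a candidate (`rFound = 1`)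
    -- and the new weight is strictly smaller. The next test, in the other branch, detects equal
    -- weights.
    .ite ((1 - ⌗rFound) + ⌗rFound * (⌗rMin - ⌗rWeight))
      (.set rFound 1 ;; .set rMin ⌗rWeight ;; .set rCol ⌗rJ ;; .set rPar ⌗rShift)
      (.ite (1 - (⌗rWeight - ⌗rMin)) (.set rPar (⌗rPar + ⌗rShift)) .skip)

/-- Treatment of one entry in the search for a pivot. -/
def scanEntry : Cmd :=
  .set rArg (entry ⌗rRow ⌗rJ) ;;
    .ite (⌗rArg * ⌗rArg)
      -- `rFound = 2` marks a pivot without bound; once it occurs, finite bounds are ignored.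
      (.ite (.read 0 (3 + 2 * ⌗rJ)) (.ite (2 - ⌗rFound) scanFinite .skip)
        (.set rFound 2 ;; .set rCol ⌗rJ))
      .skip

/-- Search for a pivot in the current row. -/
def scan : Cmd := .set rFound 0 ;; .set rJ 0 ;; forTo rJ ⌗rN scanEntry

/-- Test of the right-hand side for a pivot with finite bound. -/
def testFinite : Cmd :=
  -- Zero is treated apart, since the loop in `valuation` would not terminate on it.
  .ite (⌗rArg * ⌗rArg)
    (valuation ;;
      .ite (⌗rPar % 2)
        -- `1 - z * z` is positive exactly for `z = 0`, so this tests whether the valuation is `rMin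
        -- - 1`; the test for an even count is that it is at least `rMin`.
        (.ite (1 - (⌗rVal - ⌗rMin + 1) * (⌗rVal - ⌗rMin + 1)) .skip (.set rOk 0))
        (.ite (⌗rVal - ⌗rMin + 1) .skip (.set rOk 0)))
    (.ite (⌗rPar % 2) (.set rOk 0) .skip)

/-- Test of the right-hand side of the current row. -/
def test : Cmd :=
  .set rArg (entry ⌗rRow ⌗rN) ;;
    .ite ⌗rFound (.ite (2 - ⌗rFound) testFinite .skip) (.ite (⌗rArg * ⌗rArg) (.set rOk 0) .skip)

/-- Elimination of the pivot variable from one row. -/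
def eliminateRow : Cmd :=
  .set rFac (entry ⌗rI ⌗rCol) ;; .set rJ 0 ;;
    forTo rJ (⌗rN + 1) (.write 1 (address ⌗rI ⌗rJ)
      ((⌗rPiv * entry ⌗rI ⌗rJ - ⌗rFac * entry ⌗rRow ⌗rJ) / ⌗rDen))

/-- Elimination of the pivot variable from the rows below the current one. -/
def eliminateBelow : Cmd :=
  .set rPiv (entry ⌗rRow ⌗rCol) ;; .set rI (⌗rRow + 1) ;; forTo rI ⌗rM eliminateRow ;;
    .set rDen ⌗rPiv

/-- Treatment of one row. -/
def rowStep : Cmd := scan ;; test ;; .ite ⌗rFound eliminateBelow .skip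

/-- The whole algorithm. -/
def algorithm : Cmd :=
  prologue ;; .set rI 0 ;; forTo rI ⌗rM clearRow ;;
    .set rOk 1 ;; .set rDen 1 ;; .set rRow 0 ;; forTo rRow ⌗rM rowStep

/-! ### Numerical bounds and the representation of the data in memory -/

variable {S : ValuedSystem}

instance : Fact S.p.Prime := ⟨S.prime⟩

/-- The number of iterations of a loop, and the binary length of a number, in terms of the input
size. -/
def expo (S : ValuedSystem) : ℕ := 3 * S.size ^ 2 + 4

/-- A bound on the minors of the integral matrix. -/
def minorBound (S : ValuedSystem) : ℤ := 2 ^ (3 * S.size ^ 2)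

/-- A bound on all numbers that the algorithm writes. -/
def numBound (S : ValuedSystem) : ℤ := 2 ^ S.expo

theorem m_le_expo : S.m ≤ S.expo := by
  have := S.m_le_size
  unfold expo; nlinarith

theorem n_succ_le_expo : S.n + 1 ≤ S.expo := by
  have := S.n_le_size
  unfold expo; nlinarith

theorem two_pow_size_le_minorBound : 2 ^ S.size ≤ S.minorBound := by
  unfold minorBound
  exact pow_le_pow_right₀ one_le_two (by nlinarith [S.one_le_size])

theorem minorBound_le : 16 * S.minorBound = S.numBound := by
  unfold minorBound numBound expo
  rw [pow_add]; ring

theorem one_le_minorBound : 1 ≤ S.minorBound := one_le_pow₀ one_le_two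

theorem minorBound_le_numBound : S.minorBound ≤ S.numBound := by
  have := S.minorBound_le
  have := S.one_le_minorBound
  linarith

theorem minorBound_lt : S.minorBound < 2 ^ S.expo := by
  have := S.minorBound_le
  have := S.one_le_minorBound
  unfold numBound at *
  linarith

/-- Room for a weight, which is the sum of a valuation below `expo`, a bound of absolute value at
most `2 ^ size`, and a flag. -/
theorem expo_add_le : (S.expo : ℤ) + 2 ^ S.size + 8 ≤ S.numBound := by
  have h1 := S.minorBound_le
  have h2 := S.one_le_minorBound
  have h3 := S.two_pow_size_le_minorBound
  have h4 : (S.expo : ℤ) ≤ S.minorBound + 4 := by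
    have : 3 * S.size ^ 2 ≤ 2 ^ (3 * S.size ^ 2) := Nat.lt_two_pow_self.le
    unfold expo minorBound
    push_cast
    exact_mod_cast Nat.add_le_add_right this 4
  linarith

theorem two_pow_size_le : 2 ^ S.size ≤ S.numBound :=
  two_pow_size_le_minorBound.trans minorBound_le_numBound

theorem natCast_le_numBound {k : ℕ} (hk : k ≤ S.expo) : (k : ℤ) ≤ S.numBound := by
  have h1 := S.expo_add_le
  have h2 : (k : ℤ) ≤ S.expo := by exact_mod_cast hk
  have h3 : (0 : ℤ) ≤ 2 ^ S.size := by positivity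
  linarith

/-- Origin of the exponent `3 * size ^ 2`: with `l = size`, the factorial is at most `l ^ l ≤ 2 ^ (l
* l)`, and `l` factors of size `2 ^ (2 * l)` contribute `2 * l * l`. -/
theorem factorial_mul_pow_le :
    (S.size.factorial : ℤ) * (2 ^ (2 * S.size)) ^ S.size ≤ S.minorBound := by
  have h : S.size.factorial ≤ 2 ^ (S.size * S.size) := by
    rw [pow_mul]
    exact (Nat.factorial_le_pow S.size).trans
      (Nat.pow_le_pow_left S.size.lt_two_pow_self.le _)
  have : minorBound S = 2 ^ (S.size * S.size) * (2 ^ (2 * S.size)) ^ S.size := by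
    unfold minorBound
    rw [← pow_mul, ← pow_add]
    congr 1
    ring
  rw [this]
  exact mul_le_mul_of_nonneg_right (by exact_mod_cast h) (by positivity)

/-- The registers and cells that do not change after the prologue. -/
structure Ready (S : ValuedSystem) (s : State) : Prop where
  m : s.reg rM = S.m
  n : s.reg rN = S.n
  p : s.reg rP = S.p
  two : s.reg rTwo = (decide (S.p = 2)).toNat
  input : ∀ k, s.mem 0 k = S.encode.getD k 0

theorem Ready.of_frame {s t : State} {c : Cmd} (h : Ready S s) (hF : c.Frame s t)
    (hc : (∀ v ∈ [rM, rN, rP, rTwo], v ∉ c.regs) ∧ 0 ∉ c.arrays := by decide) : Ready S t := by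
  obtain ⟨hr, ha⟩ := hc
  refine ⟨?_, ?_, ?_, ?_, ?_⟩
  · rw [hF.reg _ (hr _ (by simp)), h.m]
  · rw [hF.reg _ (hr _ (by simp)), h.n]
  · rw [hF.reg _ (hr _ (by simp)), h.p]
  · rw [hF.reg _ (hr _ (by simp)), h.two]
  · intro k; rw [hF.mem _ ha, h.input]

/-- The working matrix. -/
def matrix (S : ValuedSystem) (s : State) (i j : ℕ) : ℤ := s.mem 1 (i * (S.n + 1) + j)

theorem address_inj {n i j i' j' : ℕ} (hj : j ≤ n) (hj' : j' ≤ n) :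
    i * (n + 1) + j = i' * (n + 1) + j' ↔ i = i' ∧ j = j' := by
  constructor
  · intro h
    have h1 : (i * (n + 1) + j) / (n + 1) = i := by
      rw [mul_comm, Nat.mul_add_div (by omega), Nat.div_eq_of_lt (by omega), add_zero]
    have h2 : (i' * (n + 1) + j') / (n + 1) = i' := by
      rw [mul_comm, Nat.mul_add_div (by omega), Nat.div_eq_of_lt (by omega), add_zero]
    have h3 : i = i' := by rw [← h1, h, h2]
    subst h3
    exact ⟨rfl, by omega⟩
  · rintro ⟨rfl, rfl⟩; rfl

theorem matrix_setMem (s : State) {i j a b : ℕ} (hj : j ≤ S.n) (hb : b ≤ S.n) (z : ℤ) :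
    S.matrix (s.setMem 1 (a * (S.n + 1) + b) z) i j =
      if i = a ∧ j = b then z else S.matrix s i j := by
  simp only [matrix, State.setMem_mem_self, address_inj hj hb]

@[simp] theorem matrix_setReg (s : State) (v : ℕ) (z : ℤ) :
    S.matrix (s.setReg v z) = S.matrix s := rfl

theorem matrix_of_frame {s t : State} {c : Cmd} (hF : c.Frame s t)
    (hc : 1 ∉ c.arrays := by decide) : S.matrix t = S.matrix s := by
  funext i j
  rw [matrix, matrix, hF.mem _ hc]

theorem eval_address {s : State} (hs : Ready S s) {i j : Expr} {a b : ℕ} (hi : i.eval s = a)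
    (hj : j.eval s = b) : ((address i j).eval s).toNat = a * (S.n + 1) + b := by
  simp only [address, Expr.eval_add, Expr.eval_mul, Expr.eval_var, Expr.eval_one, hs.n, hi, hj]
  exact_mod_cast Int.toNat_natCast _

theorem eval_entry {s : State} (hs : Ready S s) {i j : Expr} {a b : ℕ} (hi : i.eval s = a)
    (hj : j.eval s = b) : (entry i j).eval s = S.matrix s a b := by
  rw [entry, Expr.eval_read, eval_address hs hi hj, matrix]

theorem eval_coeff {s : State} (hs : Ready S s) {i j r : Expr} {a b c : ℕ} (hi : i.eval s = a)
    (hj : j.eval s = b) (hr : r.eval s = c) (ha : a < S.m) (hb : b < S.n) (hc : c < 2) :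
    (coeff i j r).eval s = (encodeRat (S.augmented a b)).getD c 0 := by
  rw [coeff, Expr.eval_read, hs.input, ← encode_matrix ha hb hc]
  congr 1
  simp only [Expr.eval_add, Expr.eval_mul, Expr.eval_var, hs.n, hi, hj, hr]
  exact_mod_cast Int.toNat_natCast _

theorem eval_rhs {s : State} (hs : Ready S s) {i r : Expr} {a c : ℕ} (hi : i.eval s = a)
    (hr : r.eval s = c) (ha : a < S.m) (hc : c < 2) :
    (rhs i r).eval s = (encodeRat (S.augmented a S.n)).getD c 0 := by
  rw [rhs, Expr.eval_read, hs.input, ← encode_rhs ha hc]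
  congr 1
  simp only [Expr.eval_add, Expr.eval_mul, Expr.eval_var, hs.m, hs.n, hi, hr]
  exact_mod_cast Int.toNat_natCast _

/-! ### Correctness of valuations and of the clearing of denominators -/

theorem padicValInt_lt {z : ℤ} {l : ℕ} (hz : z ≠ 0) (hl : |z| < 2 ^ l) : padicValInt S.p z < l := by
  have h1 : z.natAbs < 2 ^ l := by
    have : ((z.natAbs : ℕ) : ℤ) < (2 ^ l : ℕ) := by
      rw [← Int.abs_eq_natAbs]; exact_mod_cast hl
    exact_mod_cast this
  have h2 : 2 ^ padicValInt S.p z ≤ z.natAbs :=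
    (Nat.pow_le_pow_left S.prime.two_le _).trans
      (Nat.le_of_dvd (Int.natAbs_pos.mpr hz) (pow_padicValNat_dvd))
  exact (Nat.pow_lt_pow_iff_right one_lt_two).mp (h2.trans_lt h1)

/-- Correctness of the computation of valuations. -/
theorem wp_valuation {s : State} (hs : Ready S s) {Q : State → Prop} (h0 : s.reg rArg ≠ 0)
    (hB : |s.reg rArg| ≤ S.minorBound)
    (hQ : ∀ t, valuation.Frame s t → t.reg rVal = padicValInt S.p (s.reg rArg) → Q t) :
    valuation.wp S.numBound S.expo Q s := by
  refine wp_frame ?_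
  rw [valuation]
  refine ⟨by simp [numBound], ?_⟩
  -- Division by `p ≥ 2` at least halves the number, so `|rArg| < 2 ^ l` leaves fewer than `l`
  -- divisions; `v` counts those already made.
  have key : ∀ (l : ℕ) (v : ℕ) (t : State), t.reg rP = S.p → t.reg rArg ≠ 0 →
      |t.reg rArg| < 2 ^ l → l + v ≤ S.expo → t.reg rVal = v → |t.reg rArg| ≤ S.minorBound →
      padicValInt S.p (s.reg rArg) = padicValInt S.p (t.reg rArg) + v →
      loopWp (1 - ⌗rArg % ⌗rP) ((Cmd.set rArg (⌗rArg / ⌗rP) ;; .set rVal (⌗rVal + 1)).wp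
        S.numBound S.expo) (fun t => valuation.Frame s t → Q t) l t := by
    intro l
    induction l with
    | zero =>
      intro v t hp h0 hl
      exact absurd (Int.one_le_abs h0) (by simpa using hl)
    | succ l ih =>
      intro v t hp h0 hl hv hval hB heq
      have hp0 : (S.p : ℤ) ≠ 0 := by exact_mod_cast S.prime.ne_zero
      by_cases hd : (S.p : ℤ) ∣ t.reg rArg
      · right
        obtain ⟨z, hz⟩ := hd
        have hz0 : z ≠ 0 := by rintro rfl; simp [hz] at h0
        have hdiv : t.reg rArg / S.p = z := by rw [hz]; exact Int.mul_ediv_cancel_left _ hp0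
        have habs : 2 * |z| ≤ |t.reg rArg| := by
          rw [hz, abs_mul]
          refine mul_le_mul_of_nonneg_right ?_ (abs_nonneg z)
          rw [abs_of_nonneg (by positivity)]
          exact_mod_cast S.prime.two_le
        refine ⟨?_, ?_, ?_, ?_⟩
        · simp [hp, Int.emod_eq_zero_of_dvd ⟨z, hz⟩]
        · have := abs_nonneg z
          have := S.minorBound_le_numBound
          simp only [Expr.eval_div, Expr.eval_var, hp, hdiv]
          linarith
        · simp only [Expr.eval_add, Expr.eval_var, Expr.eval_one, State.setReg_reg,
            Nat.reduceEqDiff, if_false, hval]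
          rw [abs_of_nonneg (by positivity)]
          exact_mod_cast natCast_le_numBound (S := S) (k := v + 1) (by omega)
        · have hpow : (2 : ℤ) ^ (l + 1) = 2 * 2 ^ l := pow_succ' 2 l
          refine ih (v + 1) _ (by simp [hp]) (by simp [hp, hdiv, hz0]) ?_ (by omega) (by simp [hval])
            ?_ ?_
          · simp [hp, hdiv]; linarith
          · have := abs_nonneg z
            simp [hp, hdiv]; linarith
          · simp only [State.setReg_reg, Nat.reduceEqDiff, if_false, if_true, Expr.eval_div,
              Expr.eval_var, hp, hdiv]
            rw [heq, hz, padicValInt.mul hp0 hz0, padicValInt.self S.prime.one_lt]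
            ring
      · left
        refine ⟨?_, fun hF => hQ t hF ?_⟩
        · have h1 := Int.emod_nonneg (t.reg rArg) hp0
          have h2 : t.reg rArg % S.p ≠ 0 := fun h => hd (Int.dvd_of_emod_eq_zero h)
          simp only [Expr.eval_sub, Expr.eval_mod, Expr.eval_var, Expr.eval_one, hp]
          omega
        · rw [hval, heq, padicValInt.eq_zero_of_not_dvd hd, zero_add]
  exact key S.expo 0 _ (by simp [hs.p]) (by simpa using h0)
    (by simpa using hB.trans_lt minorBound_lt) (by simp) (by simp) (by simpa using hB) (by simp)

theorem wp_clearDen {s : State} (hs : Ready S s) {Q : State → Prop} {i : ℕ} (hi : s.reg rI = i)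
    (him : i < S.m) (hQ : ∀ t, clearDen.Frame s t → t.reg rDen = S.denominator i → Q t) :
    clearDen.wp S.numBound S.expo Q s := by
  have hprod : ∀ J ≤ S.n + 1, |((∏ j ∈ Finset.range J, (S.augmented i j).den : ℕ) : ℤ)| ≤
      S.numBound := fun J hJ => by
    rw [abs_of_nonneg (by positivity)]
    exact le_trans (by exact_mod_cast prod_den_le him hJ) S.two_pow_size_le
  refine wp_frame ?_
  rw [clearDen]
  refine ⟨?_, ?_, ?_⟩
  · simpa using natCast_le_numBound (S := S) (k := 1) (by unfold expo; omega)
  · simp [numBound]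
  have hs' : Ready S ((s.setReg rDen 1).setReg rJ 0) := ⟨by simp [hs.m], by simp [hs.n],
    by simp [hs.p], by simp [hs.two], by simp [hs.input]⟩
  refine wp_forTo (a := 0) (b := S.n)
    (fun J t => t.reg rDen = (∏ j ∈ Finset.range J, (S.augmented i j).den : ℕ)) (by decide)
    (by simp) (Nat.zero_le _) (by have := S.n_succ_le_expo; omega)
    (natCast_le_numBound (by have := S.n_succ_le_expo; omega)) (fun t hF => (hs'.of_frame hF).n)
    (by simp) ?_ ?_
  · intro J t _ hJ htJ hF ht
    have hti : t.reg rI = i := by rw [hF.reg rI (by decide)]; simpa using hi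
    have h1 := eval_coeff (hs'.of_frame hF) (i := ⌗rI) (j := ⌗rJ) (r := 1) (c := 1) hti htJ
      (by simp) him hJ one_lt_two
    have h2 : ((⌗rDen : Expr) * coeff ⌗rI ⌗rJ 1).eval t =
        (∏ j ∈ Finset.range (J + 1), (S.augmented i j).den : ℕ) := by
      rw [Expr.eval_mul, h1, Finset.prod_range_succ]
      simp [ht, encodeRat]
    exact ⟨by rw [h2]; exact hprod _ (by omega), by simp [h2]⟩
  · intro t htJ hF ht
    have hti : t.reg rI = i := by rw [hF.reg rI (by decide)]; simpa using hi
    have h1 := eval_rhs (hs'.of_frame hF) (i := ⌗rI) (r := 1) (c := 1) hti (by simp) him one_lt_two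
    have h2 : ((⌗rDen : Expr) * rhs ⌗rI 1).eval t = S.denominator i := by
      rw [Expr.eval_mul, h1, denominator, Finset.prod_range_succ]
      simp [ht, encodeRat]
    exact ⟨by rw [h2]; exact hprod _ le_rfl, fun hF' => hQ _ hF' (by simp [h2])⟩

theorem abs_integral_le_numBound {i j : ℕ} (hi : i < S.m) (hj : j ≤ S.n) :
    |S.integral i j| ≤ S.numBound := by
  refine (abs_integral_le hi hj).trans ?_
  unfold numBound expo
  exact pow_le_pow_right₀ one_le_two (by nlinarith [S.one_le_size])

/-- That the other rows are untouched is part of the conclusion, so that the outer loop keeps the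
finished rows. -/
theorem wp_clearRow {s : State} (hs : Ready S s) {Q : State → Prop} {i : ℕ} (hi : s.reg rI = i)
    (him : i < S.m) (hQ : ∀ t, clearRow.Frame s t → (∀ i' j, j ≤ S.n → S.matrix t i' j =
      if i' = i then S.integral i j else S.matrix s i' j) → Q t) :
    clearRow.wp S.numBound S.expo Q s := by
  refine wp_frame ?_
  rw [clearRow]
  refine wp_clearDen hs hi him fun s₁ hF₁ hD => ?_
  have hs₁ : Ready S (s₁.setReg rJ 0) := by
    have := hs.of_frame hF₁
    exact ⟨by simp [this.m], by simp [this.n], by simp [this.p], by simp [this.two],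
      by simp [this.input]⟩
  have hi₁ : s₁.reg rI = i := by rw [hF₁.reg rI (by decide)]; exact hi
  have hM₁ := matrix_of_frame (S := S) hF₁
  refine ⟨by simp [numBound], ?_⟩
  refine wp_forTo (a := 0) (b := S.n)
    (fun J t => t.reg rDen = S.denominator i ∧ ∀ i' j, j ≤ S.n → S.matrix t i' j =
      if i' = i ∧ j < J then S.integral i j else S.matrix s i' j) (by decide)
    (by simp) (Nat.zero_le _) (by have := S.n_succ_le_expo; omega)
    (natCast_le_numBound (by have := S.n_succ_le_expo; omega))
    (fun t hF => by
      have := hF.reg rN (by decide)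
      simpa [this] using hs₁.n)
    (by simp [hD, hM₁]) ?_ ?_
  · intro J t _ hJ htJ hF ⟨htD, htM⟩
    have ht := hs₁.of_frame hF
    have hti : t.reg rI = i := by rw [hF.reg rI (by decide)]; simpa using hi₁
    have h0 := eval_coeff ht (i := ⌗rI) (j := ⌗rJ) (r := 0) (c := 0) hti htJ (by simp) him hJ
      two_pos
    have h1 := eval_coeff ht (i := ⌗rI) (j := ⌗rJ) (r := 1) (c := 1) hti htJ (by simp) him hJ
      one_lt_two
    have h2 : (coeff ⌗rI ⌗rJ 0 * (⌗rDen / coeff ⌗rI ⌗rJ 1)).eval t = S.integral i J := by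
      rw [Expr.eval_mul, Expr.eval_div, h0, h1]
      simp [htD, encodeRat, integral]
    refine ⟨by rw [h2]; exact abs_integral_le_numBound him hJ.le, ?_⟩
    rw [h2, eval_address ht (i := ⌗rI) (j := ⌗rJ) hti htJ]
    refine ⟨by simpa using htD, fun i' j hj => ?_⟩
    rw [matrix_setReg, matrix_setMem _ hj hJ.le, htM i' j hj]
    by_cases h : i' = i
    · subst h
      rcases lt_trichotomy j J with h' | rfl | h'
      · simp [h', h'.ne, h'.trans (Nat.lt_succ_self J)]
      · simp
      · simp [h'.ne', h'.not_gt, Nat.not_lt.mpr h']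
    · simp [h]
  · intro t htJ hF ⟨htD, htM⟩
    have ht := hs₁.of_frame hF
    have hti : t.reg rI = i := by rw [hF.reg rI (by decide)]; simpa using hi₁
    have h0 := eval_rhs ht (i := ⌗rI) (r := 0) (c := 0) hti (by simp) him two_pos
    have h1 := eval_rhs ht (i := ⌗rI) (r := 1) (c := 1) hti (by simp) him one_lt_two
    have h2 : (rhs ⌗rI 0 * (⌗rDen / rhs ⌗rI 1)).eval t = S.integral i S.n := by
      rw [Expr.eval_mul, Expr.eval_div, h0, h1]
      simp [htD, encodeRat, integral]
    refine ⟨by rw [h2]; exact abs_integral_le_numBound him le_rfl, fun hF' => hQ _ hF' ?_⟩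
    intro i' j hj
    rw [h2, eval_address ht (i := ⌗rI) (j := ⌗rN) hti ht.n, matrix_setMem _ hj le_rfl, htM i' j hj]
    by_cases h : i' = i
    · subst h
      rcases hj.lt_or_eq with h' | rfl
      · simp [h', h'.ne]
      · simp
    · simp [h]

/-! ## The search for a pivot -/

/-- The weight of column `j` in a row. -/
def wt (S : ValuedSystem) (a : ℕ → ℤ) (j : ℕ) : ℤ := weight S.p (S.bound j) (S.exact j) (a j)

/-- The number of columns before `J` with prescribed valuation and weight `g`. -/
def tight (S : ValuedSystem) (a : ℕ → ℤ) (g : ℤ) (J : ℕ) : ℕ :=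
  ∑ j ∈ Finset.range J, if a j ≠ 0 ∧ S.wt a j = g then (S.exact j).toNat else 0

/-- The result of the search for a pivot in the first `J` columns. -/
def Scanned (S : ValuedSystem) (a : ℕ → ℤ) (J : ℕ) (t : State) : Prop :=
  (t.reg rFound = 0 ∧ ∀ j < J, a j = 0) ∨
  (t.reg rFound = 2 ∧ ∃ q < S.n, t.reg rCol = q ∧ a q ≠ 0 ∧ S.bound q = ⊥) ∨
  (t.reg rFound = 1 ∧ ∃ q < S.n, t.reg rCol = q ∧ a q ≠ 0 ∧ t.reg rMin = S.wt a q ∧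
    (∀ j < J, a j ≠ 0 → S.bound j ≠ ⊥ ∧ S.wt a q ≤ S.wt a j) ∧
    t.reg rPar = S.tight a (S.wt a q) J)

theorem tight_succ (a : ℕ → ℤ) (g : ℤ) (J : ℕ) : S.tight a g (J + 1) =
    S.tight a g J + if a J ≠ 0 ∧ S.wt a J = g then (S.exact J).toNat else 0 :=
  Finset.sum_range_succ _ _

theorem tight_eq_zero {a : ℕ → ℤ} {g : ℤ} {J : ℕ} (h : ∀ j < J, a j ≠ 0 → S.wt a j ≠ g) :
    S.tight a g J = 0 :=
  Finset.sum_eq_zero fun j hj => if_neg fun h' => h j (Finset.mem_range.mp hj) h'.1 h'.2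

theorem tight_le (a : ℕ → ℤ) (g : ℤ) (J : ℕ) : S.tight a g J ≤ J := by
  refine (Finset.sum_le_card_nsmul _ _ 1 fun j _ => ?_).trans (by simp)
  split_ifs
  exacts [Bool.toNat_le _, zero_le_one]

theorem abs_unbotD_bound_le {j : ℕ} (hj : j < S.n) : |(S.bound j).unbotD 0| ≤ 2 ^ S.size := by
  simpa [bound, hj] using abs_bound_le ⟨j, hj⟩

theorem abs_wt_le {a : ℕ → ℤ} {j : ℕ} (hj : j < S.n) (h0 : a j ≠ 0)
    (ha : |a j| ≤ S.minorBound) : |S.wt a j| ≤ S.numBound := by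
  have h1 := padicValInt_lt (S := S) h0 (ha.trans_lt minorBound_lt)
  have h2 := abs_le.mp (abs_unbotD_bound_le hj)
  have h3 := S.expo_add_le
  have h4 := Bool.toNat_le (S.exact j)
  unfold wt weight
  rw [abs_le]
  constructor <;> omega

theorem natCast_abs_le {l : ℕ} (hl : l ≤ S.expo) : |(l : ℤ)| ≤ S.numBound := by
  rw [abs_of_nonneg (by positivity)]
  exact natCast_le_numBound hl

/-- A strictly smaller weight makes column `J` the new candidate, an equal one only adds its flag to
the count, and a larger one changes nothing. -/
theorem wp_scanFinite {s : State} (hs : Ready S s) {Q : State → Prop} {a : ℕ → ℤ} {J : ℕ}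
    (hJ : s.reg rJ = J) (hJn : J < S.n) (hA : s.reg rArg = a J) (h0 : a J ≠ 0)
    (hbot : S.bound J ≠ ⊥) (hB : |a J| ≤ S.minorBound) (hfound : s.reg rFound ≠ 2)
    (hI : Scanned S a J s)
    (hQ : ∀ t, scanFinite.Frame s t → Scanned S a (J + 1) t → Q t) :
    scanFinite.wp S.numBound S.expo Q s := by
  have hn := S.n_succ_le_expo
  have hshift : (Expr.read 0 (3 + 2 * ⌗rN + ⌗rJ) * ⌗rTwo).eval s = (S.exact J).toNat := by
    have h1 : ((3 + 2 * ⌗rN + ⌗rJ : Expr).eval s).toNat = 3 + 2 * S.n + J := by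
      simp only [Expr.eval_add, Expr.eval_mul, Expr.eval_var, hJ, hs.n]
      exact_mod_cast Int.toNat_natCast _
    rw [Expr.eval_mul, Expr.eval_read, hs.input, h1, encode_flag hJn, Expr.eval_var, hs.two, exact]
    cases S.flag J <;> simp
  have hshift_le := Bool.toNat_le (S.exact J)
  refine wp_frame ?_
  rw [scanFinite]
  refine ⟨by rw [hshift]; exact natCast_abs_le (by omega), ?_⟩
  rw [hshift]
  have hr₁ : Ready S (s.setReg rShift (S.exact J).toNat) := ⟨by simp [hs.m], by simp [hs.n],
    by simp [hs.p], by simp [hs.two], by simp [hs.input]⟩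
  refine wp_valuation hr₁ (by simpa [hA] using h0) (by simpa [hA] using hB) fun s₂ hF₂ hv₂ => ?_
  have hr₂ := hr₁.of_frame hF₂
  have hreg : ∀ v, v ≠ rVal → v ≠ rArg → v ≠ rShift → s₂.reg v = s.reg v := by
    intro v h1 h2 h3
    rw [hF₂.reg v (by simp [valuation, regs, h1, h2])]
    simp [h3]
  have hS₂ : s₂.reg rShift = (S.exact J).toNat := by rw [hF₂.reg rShift (by decide)]; simp
  have hw : (⌗rVal + .read 0 (3 + 2 * ⌗rJ + 1) + ⌗rShift : Expr).eval s₂ = S.wt a J := by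
    have h1 : ((3 + 2 * ⌗rJ + 1 : Expr).eval s₂).toNat = 3 + 2 * J + 1 := by
      simp only [Expr.eval_add, Expr.eval_mul, Expr.eval_var,
        hreg rJ (by decide) (by decide) (by decide), hJ]
      exact_mod_cast Int.toNat_natCast _
    rw [Expr.eval_add, Expr.eval_add, Expr.eval_read, hr₂.input, h1, encode_bound_one hJn,
      Expr.eval_var, Expr.eval_var, hv₂, hS₂]
    simp [hA, wt, weight]
  have hwB := abs_wt_le hJn h0 hB
  refine ⟨by rw [hw]; exact hwB, ?_⟩
  rw [hw]
  set s₃ := s₂.setReg rWeight (S.wt a J) with hs₃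
  have hW₃ : s₃.reg rWeight = S.wt a J := by simp [hs₃]
  have hS₃ : s₃.reg rShift = (S.exact J).toNat := by simp [hs₃, hS₂]
  have hJ₃ : s₃.reg rJ = J := by simp [hs₃, hreg, hJ]
  have hI₃ : Scanned S a J s₃ := by simpa [Scanned, hs₃, hreg] using hI
  have hfound₃ : s₃.reg rFound ≠ 2 := by simpa [hs₃, hreg] using hfound
  have hlt : ∀ {j}, j < J + 1 → j ≠ J → j < J := fun h h' =>
    lt_of_le_of_ne (Nat.lt_succ_iff.mp h) h'
  refine ⟨fun hpos => ?_, fun hneg => ?_⟩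
  · have hnew : (∀ j < J, a j ≠ 0 → S.bound j ≠ ⊥ ∧ S.wt a J < S.wt a j) := by
      rcases hI₃ with h | h | ⟨h, q, hq, h1, h2, h3, h4, h5⟩
      · exact fun j hj hj0 => absurd (h.2 j hj) hj0
      · exact absurd h.1 hfound₃
      · simp only [Expr.eval_add, Expr.eval_sub, Expr.eval_mul, Expr.eval_var, Expr.eval_one, h, h3,
          hW₃] at hpos
        exact fun j hj hj0 => ⟨(h4 j hj hj0).1, by have := (h4 j hj hj0).2; linarith⟩
    refine ⟨natCast_abs_le (l := 1) (by omega), by simpa [hW₃] using hwB,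
      by simpa [hJ₃] using natCast_abs_le (S := S) (l := J) (by omega),
      by simpa [hS₃] using natCast_abs_le (S := S) (l := (S.exact J).toNat) (by omega),
      fun hF => hQ _ hF ?_⟩
    refine .inr (.inr ⟨by simp, J, hJn, by simp [hJ₃], h0, by simp [hW₃], fun j hj hj0 => ?_, ?_⟩)
    · by_cases hjJ : j = J
      · subst hjJ; exact ⟨hbot, le_rfl⟩
      · have := hnew j (hlt hj hjJ) hj0
        exact ⟨this.1, this.2.le⟩
    -- All earlier weights are strictly larger, so the count for the new minimum restarts with the
    -- flag of `J` alone.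
    · rw [tight_succ, tight_eq_zero fun j hj hj0 => (hnew j hj hj0).2.ne', if_pos ⟨h0, rfl⟩]
      simp [hS₃]
  · obtain ⟨h, q, hq, h1, h2, h3, h4, h5⟩ : s₃.reg rFound = 1 ∧ ∃ q < S.n, s₃.reg rCol = q ∧
        a q ≠ 0 ∧ s₃.reg rMin = S.wt a q ∧
        (∀ j < J, a j ≠ 0 → S.bound j ≠ ⊥ ∧ S.wt a q ≤ S.wt a j) ∧
        s₃.reg rPar = S.tight a (S.wt a q) J := by
      rcases hI₃ with h | h | h
      · simp [h.1] at hneg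
      · exact absurd h.1 hfound₃
      · exact h
    have hle : S.wt a q ≤ S.wt a J := by
      simp only [Expr.eval_add, Expr.eval_sub, Expr.eval_mul, Expr.eval_var, Expr.eval_one, h, h3,
        hW₃] at hneg
      linarith
    have hall : ∀ j < J + 1, a j ≠ 0 → S.bound j ≠ ⊥ ∧ S.wt a q ≤ S.wt a j := by
      intro j hj hj0
      by_cases hjJ : j = J
      · subst hjJ; exact ⟨hbot, hle⟩
      · exact h4 j (hlt hj hjJ) hj0
    refine ⟨fun hpos => ?_, fun hneg => ?_⟩
    · have heq : S.wt a J = S.wt a q := by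
        simp only [Expr.eval_sub, Expr.eval_var, Expr.eval_one, h3, hW₃] at hpos
        omega
      have hpar : (⌗rPar + ⌗rShift : Expr).eval s₃ = S.tight a (S.wt a q) (J + 1) := by
        rw [tight_succ, if_pos ⟨h0, heq⟩, Expr.eval_add, Expr.eval_var, Expr.eval_var, h5, hS₃]
        push_cast; rfl
      refine ⟨?_, fun hF => hQ _ hF ?_⟩
      · rw [hpar]
        exact natCast_abs_le ((tight_le _ _ _).trans (by omega))
      · rw [hpar]
        exact .inr (.inr ⟨by simpa using h, q, hq, by simpa using h1, h2, by simpa using h3, hall,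
          by simp⟩)
    · have hne : S.wt a J ≠ S.wt a q := by
        simp only [Expr.eval_sub, Expr.eval_var, Expr.eval_one, h3, hW₃] at hneg
        omega
      refine fun hF => hQ _ hF (.inr (.inr ⟨h, q, hq, h1, h2, h3, hall, ?_⟩))
      rw [tight_succ, if_neg fun h => hne h.2, h5, add_zero]

theorem wp_scanEntry {s : State} (hs : Ready S s) {Q : State → Prop} {k J : ℕ}
    (hk : s.reg rRow = k) (hJ : s.reg rJ = J) (hJn : J < S.n)
    (hB : |S.matrix s k J| ≤ S.minorBound) (hI : Scanned S (S.matrix s k) J s)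
    (hQ : ∀ t, scanEntry.Frame s t → Scanned S (S.matrix s k) (J + 1) t → Q t) :
    scanEntry.wp S.numBound S.expo Q s := by
  refine wp_frame ?_
  set a := S.matrix s k with ha
  have hentry : (entry ⌗rRow ⌗rJ).eval s = a J := eval_entry hs hk hJ
  have hn := S.n_succ_le_expo
  rw [scanEntry]
  refine ⟨by rw [hentry]; exact hB.trans minorBound_le_numBound, ?_⟩
  rw [hentry]
  set s₁ := s.setReg rArg (a J) with hs₁
  have hr₁ : Ready S s₁ := ⟨by simp [hs₁, hs.m], by simp [hs₁, hs.n], by simp [hs₁, hs.p],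
    by simp [hs₁, hs.two], by simp [hs₁, hs.input]⟩
  have hJ₁ : s₁.reg rJ = J := by simp [hs₁, hJ]
  have hA₁ : s₁.reg rArg = a J := by simp [hs₁]
  have hI₁ : Scanned S a J s₁ := by simpa [Scanned, hs₁] using hI
  have haddr : ((3 + 2 * ⌗rJ : Expr).eval s₁).toNat = 3 + 2 * J := by
    simp only [Expr.eval_add, Expr.eval_mul, Expr.eval_var, hJ₁]
    exact_mod_cast Int.toNat_natCast _
  have hflag : (Expr.read 0 (3 + 2 * ⌗rJ)).eval s₁ = if S.bound J = ⊥ then 0 else 1 := by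
    rw [Expr.eval_read, hr₁.input, haddr, encode_bound_zero hJn]
  refine ⟨fun hpos => ?_, fun hneg => ?_⟩
  · have hne : a J ≠ 0 := by rintro h; simp [hA₁, h] at hpos
    refine ⟨fun hpos => ⟨fun hpos' => ?_, fun hneg => ?_⟩, fun hneg => ?_⟩
    · have hbot : S.bound J ≠ ⊥ := by intro h; simp [hflag, h] at hpos
      have hfound : s₁.reg rFound < 2 := by simpa using hpos'
      have hfound' : s₁.reg rFound ≠ 2 := hfound.ne
      exact wp_scanFinite hr₁ hJ₁ hJn hA₁ hne hbot hB hfound' hI₁ fun t _ ht hF => hQ t hF ht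
    · have hbot : S.bound J ≠ ⊥ := by intro h; simp [hflag, h] at hpos
      have hfound : 2 ≤ s₁.reg rFound := by simpa using hneg
      refine fun hF => hQ _ hF ?_
      rcases hI₁ with h | h | h
      · omega
      · exact .inr (.inl h)
      · omega
    · have hbot : S.bound J = ⊥ := by
        by_contra h
        simp [hflag, h] at hneg
      refine ⟨?_, ?_, fun hF => hQ _ hF ?_⟩
      · exact natCast_abs_le (l := 2) (by omega)
      · simpa [hJ₁] using natCast_abs_le (S := S) (l := J) (by omega)
      · exact .inr (.inl ⟨by simp, J, hJn, by simp [hJ₁], hne, hbot⟩)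
  · have hzero : a J = 0 := by
      by_contra h
      simp only [Expr.eval_mul, Expr.eval_var, hA₁] at hneg
      exact absurd (mul_self_pos.mpr h) (not_lt.mpr hneg)
    refine fun hF => hQ _ hF ?_
    have hlt : ∀ {j}, j < J + 1 → a j ≠ 0 → j < J := fun h h' =>
      lt_of_le_of_ne (Nat.lt_succ_iff.mp h) (by rintro rfl; exact h' hzero)
    rcases hI₁ with h | h | ⟨h, q, hq, h1, h2, h3, h4, h5⟩
    · refine .inl ⟨h.1, fun j hj => ?_⟩
      by_contra h'
      exact h' (h.2 j (hlt hj h'))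
    · exact .inr (.inl h)
    · refine .inr (.inr ⟨h, q, hq, h1, h2, h3, fun j hj h' => h4 j (hlt hj h') h', ?_⟩)
      rw [tight_succ, if_neg (by simp [hzero]), h5, add_zero]

theorem wp_scan {s : State} (hs : Ready S s) {Q : State → Prop} {k : ℕ}
    (hk : s.reg rRow = k) (hB : ∀ j < S.n, |S.matrix s k j| ≤ S.minorBound)
    (hQ : ∀ t, scan.Frame s t → Scanned S (S.matrix s k) S.n t → Q t) :
    scan.wp S.numBound S.expo Q s := by
  have hn := S.n_succ_le_expo
  refine wp_frame ?_
  rw [scan]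
  refine ⟨natCast_abs_le (l := 0) (by omega), natCast_abs_le (l := 0) (by omega), ?_⟩
  have hs' : Ready S ((s.setReg rFound 0).setReg rJ 0) := ⟨by simp [hs.m], by simp [hs.n],
    by simp [hs.p], by simp [hs.two], by simp [hs.input]⟩
  refine wp_forTo (a := 0) (b := S.n) (Scanned S (S.matrix s k)) (by decide)
    (by simp) (Nat.zero_le _) (by omega) (natCast_le_numBound (by omega))
    (fun t hF => (hs'.of_frame hF).n) (.inl ⟨by simp, by simp⟩) ?_ ?_
  · intro J t _ hJ htJ hF hI
    have hm : S.matrix t = S.matrix s := by rw [matrix_of_frame hF]; rfl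
    rw [← hm] at hI hB ⊢
    refine wp_scanEntry (hs'.of_frame hF) ?_ htJ hJ (hB J hJ) hI fun u _ hu => ?_
    · rw [hF.reg rRow (by decide)]; simpa using hk
    · simpa [Scanned] using hu
  · exact fun t _ _ hI hF => hQ t hF hI

/-! ## The test of the right-hand side -/

/-- The condition that the current row imposes on its right-hand side `β`, given the result of the
search for a pivot. -/
def Passes (S : ValuedSystem) (β : ℤ) (t : State) : Prop :=
  (t.reg rFound = 0 → β = 0) ∧
  (t.reg rFound = 1 → if Odd (t.reg rPar) then ValEq S.p (t.reg rMin - 1) β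
    else ValGe S.p (t.reg rMin) β)

/-- The flag `rOk` is only ever lowered, so an earlier failure persists although the elimination
continues. -/
theorem wp_test {s : State} (hs : Ready S s) {Q : State → Prop} {a : ℕ → ℤ} {k : ℕ}
    (hk : s.reg rRow = k) (hB : |S.matrix s k S.n| ≤ S.minorBound) (hI : Scanned S a S.n s)
    (hQ : ∀ t, test.Frame s t → (Passes S (S.matrix s k S.n) s → t.reg rOk = s.reg rOk) →
      (¬ Passes S (S.matrix s k S.n) s → t.reg rOk = 0) → Q t) :
    test.wp S.numBound S.expo Q s := by
  have hzero : |(0 : ℤ)| ≤ S.numBound := natCast_abs_le (S := S) (l := 0) (Nat.zero_le _)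
  refine wp_frame ?_
  set β := S.matrix s k S.n with hβ
  have hentry : (entry ⌗rRow ⌗rN).eval s = β := eval_entry hs hk hs.n
  rw [test]
  refine ⟨by rw [hentry]; exact hB.trans minorBound_le_numBound, ?_⟩
  rw [hentry]
  set s₁ := s.setReg rArg β with hs₁
  have hr₁ : Ready S s₁ := ⟨by simp [hs₁, hs.m], by simp [hs₁, hs.n], by simp [hs₁, hs.p],
    by simp [hs₁, hs.two], by simp [hs₁, hs.input]⟩
  have hreg : ∀ v, v ≠ rArg → s₁.reg v = s.reg v := fun v hv => by simp [hs₁, hv]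
  have hA₁ : s₁.reg rArg = β := by simp [hs₁]
  have hpass : Passes S β s → ∀ t : State, t.reg rOk = s.reg rOk → test.Frame s t → Q t :=
    fun h t ht hF => hQ t hF (fun _ => ht) fun h' => absurd h h'
  have hfail : ¬ Passes S β s → ∀ t : State, t.reg rOk = 0 → test.Frame s t → Q t :=
    fun h t ht hF => hQ t hF (fun h' => absurd h' h) fun _ => ht
  have hsq : (⌗rArg * ⌗rArg : Expr).eval s₁ = β * β := by simp [hA₁]
  have hpar : Odd (s.reg rPar) ↔ 0 < (⌗rPar % 2 : Expr).eval s := by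
    simp only [Expr.eval_mod, Expr.eval_var, Expr.eval_ofNat, Int.odd_iff]
    omega
  refine ⟨fun hf => ⟨fun hf2 => ?_, fun hf2 => ?_⟩, fun hf => ⟨fun hsqr => ?_, fun hsqr => ?_⟩⟩
  · have hfound : s.reg rFound = 1 := by
      rw [Expr.eval_var, hreg _ (by decide)] at hf
      rw [Expr.eval_sub, Expr.eval_var, hreg _ (by decide), Expr.eval_ofNat] at hf2
      omega
    rw [testFinite]
    refine ⟨fun hsqr => ?_, fun hsqr => ?_⟩
    · have hβ0 : β ≠ 0 := by rintro h; simp [hsq, h] at hsqr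
      have hβ0' : (β : ℚ) ≠ 0 := by exact_mod_cast hβ0
      refine wp_valuation hr₁ (by rwa [hA₁]) (by rwa [hA₁]) fun t hF ht => ?_
      rw [hA₁] at ht
      have hregt : ∀ v, v ≠ rVal → v ≠ rArg → t.reg v = s.reg v := fun v h1 h2 => by
        rw [hF.reg v (by simp [valuation, regs, h1, h2]), hreg v h2]
      have hpart : (⌗rPar % 2 : Expr).eval t = (⌗rPar % 2 : Expr).eval s := by
        simp [hregt]
      have hP : Passes S β s ↔ if Odd (s.reg rPar) then t.reg rVal = t.reg rMin - 1
          else t.reg rMin ≤ t.reg rVal := by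
        simp [Passes, hfound, ValEq, ValGe, hβ0, ht, hregt]
      refine ⟨fun hodd => ?_, fun hodd => ?_⟩ <;> rw [hpart] at hodd
      · rw [if_pos (hpar.mpr hodd)] at hP
        refine ⟨fun h => hpass (hP.mpr ?_) _ (hregt _ (by decide) (by decide)),
          fun h => ⟨hzero, hfail (fun h' => ?_) _ (by simp)⟩⟩
        · simp only [Expr.eval_sub, Expr.eval_mul, Expr.eval_add, Expr.eval_var,
            Expr.eval_one] at h
          by_contra hne
          have : t.reg rVal - t.reg rMin + 1 ≠ 0 := fun h => hne (by omega)
          have := mul_self_pos.mpr this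
          omega
        · rw [hP] at h'
          simp [h'] at h
      · rw [if_neg (fun h => absurd (hpar.mp h) (not_lt.mpr hodd))] at hP
        refine ⟨fun h => hpass (hP.mpr ?_) _ (hregt _ (by decide) (by decide)),
          fun h => ⟨hzero, hfail (fun h' => ?_) _ (by simp)⟩⟩
        · simp only [Expr.eval_sub, Expr.eval_add, Expr.eval_var, Expr.eval_one] at h
          omega
        · rw [hP] at h'
          simp only [Expr.eval_sub, Expr.eval_add, Expr.eval_var, Expr.eval_one] at h
          omega
    -- Zero has infinite valuation: it satisfies every lower bound and no exact condition, so the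
    -- parity decides.
    · have hβ0 : β = 0 := by
        by_contra h
        rw [hsq] at hsqr
        exact absurd (mul_self_pos.mpr h) (not_lt.mpr hsqr)
      have hpart : (⌗rPar % 2 : Expr).eval s₁ = (⌗rPar % 2 : Expr).eval s := by
        simp [hreg]
      refine ⟨fun hodd => ⟨hzero, hfail (fun h' => ?_) _ (by simp)⟩,
        fun hodd => hpass ⟨fun h => by simp [hfound] at h, fun _ => ?_⟩ _
          (hreg _ (by decide))⟩ <;> rw [hpart] at hodd
      · have := h'.2 hfound
        rw [if_pos (hpar.mpr hodd)] at this
        exact this.1 (by simp [hβ0])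
      · rw [if_neg (fun h => absurd (hpar.mp h) (not_lt.mpr hodd)), hβ0]
        simpa using valGe_zero
  · have hfound : 2 ≤ s.reg rFound := by
      rw [Expr.eval_sub, Expr.eval_var, hreg _ (by decide), Expr.eval_ofNat] at hf2
      omega
    exact hpass ⟨fun h => by omega, fun h => by omega⟩ _ (hreg _ (by decide))
  all_goals
    have hfound : s.reg rFound = 0 := by
      rw [Expr.eval_var, hreg _ (by decide)] at hf
      rcases hI with h | h | h <;> omega
  · refine ⟨hzero, hfail (fun h' => ?_) _ (by simp)⟩
    rw [hsq, h'.1 hfound] at hsqr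
    simp at hsqr
  · refine hpass ⟨fun _ => ?_, fun h => by omega⟩ _ (hreg _ (by decide))
    by_contra h
    rw [hsq] at hsqr
    exact absurd (mul_self_pos.mpr h) (not_lt.mpr hsqr)

/-! ## Elimination -/

/-- The minors have at most `k + 1 ≤ m` rows, and `m` is at most the input size. -/
theorem abs_le_minorBound {k : ℕ} {d : ℤ} {W : ℕ → ℕ → ℤ}
    (h : Bareiss S.integral S.m S.n k d W) {i j : ℕ} (hk : k ≤ i) (hi : i < S.m) (hj : j ≤ S.n) :
    |W i j| ≤ S.minorBound :=
  (h.abs_entry_le (one_le_pow₀ one_le_two) (fun _ _ => abs_integral_le)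
    (by have := S.m_le_size; omega) hk hi hj).trans factorial_mul_pow_le

/-- The loop overwrites the entry in column `q` that it still needs, hence the copy in `rFac`.
Entries from column `J` on still have their old values. Only the quotient is stored, so the
numerator needs no bound here. -/
theorem wp_eliminateRow {s : State} (hs : Ready S s) {Q : State → Prop} {W : ℕ → ℕ → ℤ}
    {k q i : ℕ} (hk : s.reg rRow = k) (hq : s.reg rCol = q) (hqn : q ≤ S.n) (hi : s.reg rI = i)
    (hki : k ≠ i) (hpiv : s.reg rPiv = W k q) (hWk : ∀ j ≤ S.n, S.matrix s k j = W k j)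
    (hWi : ∀ j ≤ S.n, S.matrix s i j = W i j) (hWB : |W i q| ≤ S.numBound)
    (hB : ∀ j ≤ S.n, |eliminate W k q (s.reg rDen) i j| ≤ S.numBound)
    (hQ : ∀ t, eliminateRow.Frame s t → (∀ i' j, j ≤ S.n → S.matrix t i' j =
      if i' = i then eliminate W k q (s.reg rDen) i j else S.matrix s i' j) → Q t) :
    eliminateRow.wp S.numBound S.expo Q s := by
  have hn := S.n_succ_le_expo
  refine wp_frame ?_
  have hentry : (entry ⌗rI ⌗rCol).eval s = W i q := by
    rw [eval_entry hs (i := ⌗rI) (j := ⌗rCol) hi hq, hWi q hqn]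
  rw [eliminateRow]
  refine ⟨by rwa [hentry], natCast_abs_le (l := 0) (by omega), ?_⟩
  rw [hentry]
  set s₁ := (s.setReg rFac (W i q)).setReg rJ 0 with hs₁
  have hr₁ : Ready S s₁ := ⟨by simp [hs₁, hs.m], by simp [hs₁, hs.n], by simp [hs₁, hs.p],
    by simp [hs₁, hs.two], by simp [hs₁, hs.input]⟩
  change (forTo _ _ _).wp _ _ _ s₁
  refine wp_forTo (a := 0) (b := S.n + 1) (fun J t => ∀ i' j, j ≤ S.n → S.matrix t i' j =
      if i' = i ∧ j < J then eliminate W k q (s.reg rDen) i j else S.matrix s i' j) (by decide)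
    (by simp [hs₁]) (Nat.zero_le _) (by omega) (natCast_le_numBound (by omega))
    (fun t hF => ?_) (fun i' j hj => ?_) ?_ ?_
  · have h := hF.reg rN (by decide)
    simp [h, hr₁.n]
  · simp [hs₁]
  · intro J t _ hJ htJ hF htM
    have hJn : J ≤ S.n := Nat.lt_succ_iff.mp hJ
    have ht := hr₁.of_frame hF
    have hreg : ∀ v, v ≠ rJ → v ≠ rFac → t.reg v = s.reg v := fun v h1 h2 => by
      rw [hF.reg v (by simp [forTo, regs, h1])]
      simp [hs₁, h1, h2]
    have hfac : t.reg rFac = W i q := by rw [hF.reg rFac (by decide)]; simp [hs₁]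
    have hval : ((⌗rPiv * entry ⌗rI ⌗rJ - ⌗rFac * entry ⌗rRow ⌗rJ) / ⌗rDen : Expr).eval t =
        eliminate W k q (s.reg rDen) i J := by
      have hi' : (⌗rI).eval t = i := (hreg rI (by decide) (by decide)).trans hi
      have hk' : (⌗rRow).eval t = k := (hreg rRow (by decide) (by decide)).trans hk
      have hj' : (⌗rJ).eval t = J := htJ
      rw [Expr.eval_div, Expr.eval_sub, Expr.eval_mul, Expr.eval_mul, eval_entry ht hi' hj',
        eval_entry ht hk' hj', htM i J hJn, htM k J hJn, if_neg (by simp), if_neg (by simp [hki]),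
        hWi J hJn, hWk J hJn, Expr.eval_var, Expr.eval_var, Expr.eval_var, hfac,
        hreg rPiv (by decide) (by decide), hreg rDen (by decide) (by decide), hpiv, eliminate]
    refine ⟨by rw [hval]; exact hB J hJn, ?_⟩
    rw [hval, eval_address ht (i := ⌗rI) (j := ⌗rJ)
      ((hreg rI (by decide) (by decide)).trans hi) htJ]
    intro i' j hj
    rw [matrix_setReg, matrix_setMem _ hj hJn, htM i' j hj]
    by_cases h : i' = i
    · subst h
      rcases lt_trichotomy j J with h' | rfl | h'
      · simp [h', h'.ne, h'.trans (Nat.lt_succ_self J)]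
      · simp
      · simp [h'.ne', h'.not_gt, Nat.not_lt.mpr h']
    · simp [h]
  · intro t _ hF htM hF'
    refine hQ t hF' fun i' j hj => ?_
    rw [htM i' j hj]
    simp [Nat.lt_succ_iff.mpr hj]

/-- The quotients are bounded because `Bareiss.step` shows them to be minors again. The divisor
`rDen` is replaced by the pivot only after the last row. -/
theorem wp_eliminateBelow {s : State} (hs : Ready S s) {Q : State → Prop} {k q : ℕ}
    (hk : s.reg rRow = k) (hkm : k < S.m) (hq : s.reg rCol = q) (hqn : q < S.n)
    (hBar : Bareiss S.integral S.m S.n k (s.reg rDen) (S.matrix s)) (hne : S.matrix s k q ≠ 0)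
    (hQ : ∀ t, eliminateBelow.Frame s t → t.reg rDen = S.matrix s k q →
      (∀ i j, k < i → i < S.m → j ≤ S.n →
        S.matrix t i j = eliminate (S.matrix s) k q (s.reg rDen) i j) → Q t) :
    eliminateBelow.wp S.numBound S.expo Q s := by
  have hm := S.m_le_expo
  have hstep := hBar.step hkm hqn.le hne
  set W := S.matrix s with hW
  have hentry : (entry ⌗rRow ⌗rCol).eval s = W k q := eval_entry hs hk hq
  refine wp_frame ?_
  rw [eliminateBelow]
  have hpivB : |W k q| ≤ S.numBound :=
    (abs_le_minorBound hBar le_rfl hkm hqn.le).trans minorBound_le_numBound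
  have hi0 : (⌗rRow + 1 : Expr).eval (s.setReg rPiv (W k q)) = (k + 1 : ℕ) := by simp [hk]
  refine ⟨by rwa [hentry], ?_, ?_⟩
  · rw [hentry, hi0]; exact natCast_abs_le (by omega)
  rw [hentry, hi0]
  set s₁ := (s.setReg rPiv (W k q)).setReg rI (k + 1 : ℕ) with hs₁
  have hr₁ : Ready S s₁ := ⟨by simp [hs₁, hs.m], by simp [hs₁, hs.n], by simp [hs₁, hs.p],
    by simp [hs₁, hs.two], by simp [hs₁, hs.input]⟩
  have hreg : ∀ t, (forTo rI ⌗rM eliminateRow).Frame s₁ t → ∀ v, v ≠ rI → v ≠ rJ → v ≠ rFac →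
      v ≠ rPiv → t.reg v = s.reg v := fun t hF v h1 h2 h3 h4 => by
    rw [hF.reg v (by simp [forTo, eliminateRow, regs, h1, h2, h3])]
    simp [hs₁, h1, h4]
  refine wp_forTo (a := k + 1) (b := S.m) (fun I t => ∀ i j, j ≤ S.n → S.matrix t i j =
      if k < i ∧ i < I then eliminate W k q (s.reg rDen) i j else W i j) (by decide)
    (by simp [hs₁]) (by omega) (by omega) (natCast_le_numBound (by omega))
    (fun t hF => (hr₁.of_frame hF).m) (fun i j hj => ?_) ?_ ?_
  · rw [if_neg (by omega)]; simp [hs₁, hW]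
  · intro I t hkI hIm htI hF htM
    have hpiv : t.reg rPiv = W k q := by rw [hF.reg rPiv (by decide)]; simp [hs₁]
    have hden := hreg t hF rDen (by decide) (by decide) (by decide) (by decide)
    refine wp_eliminateRow (hr₁.of_frame hF) (W := W) (k := k) (q := q) (i := I)
      (by rw [hreg t hF rRow (by decide) (by decide) (by decide) (by decide), hk])
      (by rw [hreg t hF rCol (by decide) (by decide) (by decide) (by decide), hq]) hqn.le htI
      (by omega) hpiv (fun j hj => by rw [htM k j hj, if_neg (by omega)])
      (fun j hj => by rw [htM I j hj, if_neg (by omega)])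
      ((abs_le_minorBound hBar (by omega) hIm hqn.le).trans minorBound_le_numBound)
      (fun j hj => ?_) fun u _ hu i j hj => ?_
    · rw [hden]
      exact (abs_le_minorBound hstep hkI hIm hj).trans minorBound_le_numBound
    · rw [matrix_setReg, hu i j hj, htM i j hj, hden]
      by_cases h : i = I
      · subst h
        rw [if_pos rfl, if_pos (by omega)]
      · rw [if_neg h]
        congr 1
        simp only [eq_iff_iff]
        omega
  · intro t _ hF htM
    have hpiv : t.reg rPiv = W k q := by rw [hF.reg rPiv (by decide)]; simp [hs₁]
    refine ⟨by simpa [hpiv] using hpivB, fun hF' => hQ _ hF' (by simp [hpiv]) ?_⟩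
    intro i j hki him hj
    rw [matrix_setReg, htM i j hj, if_pos ⟨hki, him⟩]

/-! ## Correctness -/

/-- The invariant of the main loop. -/
structure Invariant (S : ValuedSystem) (k : ℕ) (t : State) : Prop where
  ok : t.reg rOk = 0 ∨ t.reg rOk = 1
  bareiss : Bareiss S.integral S.m S.n k (t.reg rDen) (S.matrix t)
  solvable : S.Solvable ↔ t.reg rOk = 1 ∧
    RowsSolvable S.p S.m S.n S.bound S.exact k (S.matrix t)

/-- Joins the result of the search to `admissible_pivot_iff`: `rPar` counts the tight columns of
minimal weight. For a pivot without bound both sides hold trivially. -/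
theorem passes_iff {W : ℕ → ℕ → ℤ} {s : State} {k q : ℕ} {β : ℤ} (hq : q < S.n)
    (hqs : s.reg rCol = q) (hI : Scanned S (W k) S.n s) (h0 : s.reg rFound ≠ 0) (x : ℕ → ℚ)
    (hx : ∀ j < S.n, j ≠ q → Admissible S.p (S.bound j) (S.exact j) (x j))
    (hβ : ∑ j ∈ Finset.range S.n, (W k j : ℚ) * x j = β) :
    Admissible S.p (S.bound q) (S.exact q) (x q) ↔ Passes S β s := by
  rcases hI with h | ⟨h, q', _, hq', _, hbot⟩ | ⟨h, q', _, hq', hne, hmin, hc, hpar⟩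
  · exact absurd h.1 h0
  · obtain rfl : q' = q := by have := hq'.symm.trans hqs; exact_mod_cast this
    refine iff_of_true (fun k hk => ?_) ⟨fun h' => by omega, fun h' => by omega⟩
    rw [hbot] at hk
    exact absurd hk.symm WithBot.coe_ne_bot
  · obtain rfl : q' = q := by have := hq'.symm.trans hqs; exact_mod_cast this
    rw [admissible_pivot_iff (fun j => exact_eq_true) hq hne hc hx hβ]
    have h1 : Passes S β s ↔ if Odd (s.reg rPar) then ValEq S.p (s.reg rMin - 1) β
        else ValGe S.p (s.reg rMin) β :=
      ⟨fun h' => h'.2 h, fun h' => ⟨fun h'' => by omega, fun _ => h'⟩⟩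
    have h2 : Odd (s.reg rPar) ↔ Odd (S.tight (W k) (S.wt (W k) q') S.n) := by
      rw [hpar, Int.odd_coe_nat]
    rw [h1, hmin]
    by_cases ho : Odd (S.tight (W k) (S.wt (W k) q') S.n)
    · rw [if_pos (h2.mpr ho)]
      exact iff_of_eq (if_pos ho)
    · rw [if_neg (mt h2.mp ho)]
      exact iff_of_eq (if_neg ho)

/-- With a pivot, `rowsSolvable_iff_of_pivot` applies with `Passes` as the condition on the
right-hand side; without one, the row is zero and `rowsSolvable_iff_of_zero` applies. -/
theorem wp_rowStep {s : State} (hs : Ready S s) {Q : State → Prop} {k : ℕ}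
    (hk : s.reg rRow = k) (hkm : k < S.m) (hI : Invariant S k s)
    (hQ : ∀ t, Invariant S (k + 1) t → Q t) : rowStep.wp S.numBound S.expo Q s := by
  rw [rowStep]
  refine wp_scan hs hk (fun j hj => abs_le_minorBound hI.bareiss le_rfl hkm hj.le)
    fun s₁ hF₁ hscan => ?_
  have hr₁ := hs.of_frame hF₁
  have hm₁ : S.matrix s₁ = S.matrix s := matrix_of_frame hF₁
  have hk₁ : s₁.reg rRow = k := by rw [hF₁.reg rRow (by decide), hk]
  have hok₁ : s₁.reg rOk = s.reg rOk := hF₁.reg rOk (by decide)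
  have hd₁ : s₁.reg rDen = s.reg rDen := hF₁.reg rDen (by decide)
  rw [← hm₁] at hscan
  have hI₁ : Invariant S k s₁ :=
    ⟨by rw [hok₁]; exact hI.ok, by rw [hd₁, hm₁]; exact hI.bareiss,
      by rw [hok₁, hm₁]; exact hI.solvable⟩
  refine wp_test hr₁ hk₁ (abs_le_minorBound hI₁.bareiss le_rfl hkm le_rfl) hscan
    fun s₂ hF₂ hpass hfail => ?_
  have hr₂ := hr₁.of_frame hF₂
  have hm₂ : S.matrix s₂ = S.matrix s₁ := matrix_of_frame hF₂
  have hreg₂ : ∀ v, v ≠ rOk → v ≠ rArg → v ≠ rVal → s₂.reg v = s₁.reg v := fun v h1 h2 h3 =>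
    hF₂.reg v (by simp [test, testFinite, valuation, regs, h1, h2, h3])
  have hok₂ : s₂.reg rOk = 0 ∨ s₂.reg rOk = 1 := by
    by_cases h : Passes S (S.matrix s₁ k S.n) s₁
    · rw [hpass h]; exact hI₁.ok
    · exact .inl (hfail h)
  have hokiff : s₂.reg rOk = 1 ↔ s₁.reg rOk = 1 ∧ Passes S (S.matrix s₁ k S.n) s₁ := by
    by_cases h : Passes S (S.matrix s₁ k S.n) s₁
    · simp [hpass h, h]
    · simp [hfail h, h]
  have hd₂ : s₂.reg rDen = s₁.reg rDen := hreg₂ _ (by decide) (by decide) (by decide)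
  have hfound₂ : s₂.reg rFound = s₁.reg rFound := hreg₂ _ (by decide) (by decide) (by decide)
  refine ⟨fun hpos => ?_, fun hneg => hQ _ ⟨hok₂, ?_, ?_⟩⟩
  · rw [Expr.eval_var, hfound₂] at hpos
    obtain ⟨q, hq, hqs, hne⟩ : ∃ q < S.n, s₁.reg rCol = q ∧ S.matrix s₁ k q ≠ 0 := by
      rcases hscan with h | ⟨_, q, hq, h1, h2, _⟩ | ⟨_, q, hq, h1, h2, _⟩
      · omega
      · exact ⟨q, hq, h1, h2⟩
      · exact ⟨q, hq, h1, h2⟩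
    refine wp_eliminateBelow hr₂ (by rw [hreg₂ _ (by decide) (by decide) (by decide), hk₁]) hkm
      (by rw [hreg₂ _ (by decide) (by decide) (by decide), hqs]) hq
      (by rw [hd₂, hm₂]; exact hI₁.bareiss) (by rwa [hm₂]) fun s₃ hF₃ hd₃ hm₃ => hQ _ ?_
    rw [hm₂] at hd₃ hm₃
    rw [hd₂] at hm₃
    have hok₃ : s₃.reg rOk = s₂.reg rOk := hF₃.reg rOk (by decide)
    refine ⟨by rwa [hok₃], ?_, ?_⟩
    · rw [hd₃]
      exact (hI₁.bareiss.step hkm hq.le hne).congr fun i j hki hi hj => hm₃ i j hki hi hj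
    · rw [hI₁.solvable, hok₃, hokiff, rowsSolvable_congr (fun i j hki hi hj => hm₃ i j hki hi hj),
        rowsSolvable_iff_of_pivot hkm hq hne hI₁.bareiss.ne_zero
          (fun i j hki hi hj => hI₁.bareiss.mul_eliminate hq.le hki.le hi hj)
          (passes_iff hq hqs hscan (by omega)), and_assoc]
  · rw [hd₂, hm₂]; exact hI₁.bareiss.succ
  · rw [Expr.eval_var, hfound₂] at hneg
    obtain ⟨hf, hzero⟩ : s₁.reg rFound = 0 ∧ ∀ j < S.n, S.matrix s₁ k j = 0 := by
      rcases hscan with h | h | h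
      · exact h
      · omega
      · omega
    have hP : Passes S (S.matrix s₁ k S.n) s₁ ↔ S.matrix s₁ k S.n = 0 :=
      ⟨fun h => h.1 hf, fun h => ⟨fun _ => h, fun h' => by omega⟩⟩
    rw [hI₁.solvable, hokiff, hm₂, hP, rowsSolvable_iff_of_zero hkm hzero, and_assoc]

theorem wp_prologue {Q : State → Prop} (hQ : ∀ t, Ready S t → Q t) :
    prologue.wp S.numBound S.expo Q (init S.encode) := by
  have hm := S.m_le_expo
  have hn := S.n_succ_le_expo
  have hinit : ∀ k, (init S.encode).mem 0 k = S.encode.getD k 0 := fun k => rfl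
  have hm₀ : (init S.encode).mem 0 0 = S.m := rfl
  have hn₀ : (init S.encode).mem 0 1 = S.n := rfl
  have hp₀ : (init S.encode).mem 0 2 = S.p := rfl
  have h2 := S.prime.two_le
  rw [prologue]
  refine ⟨?_, ?_, ?_, fun hp => ⟨?_, hQ _ ?_⟩, fun hp => ⟨?_, hQ _ ?_⟩⟩
  · simpa [hm₀] using natCast_abs_le hm
  · simpa [hn₀] using natCast_abs_le (S := S) (l := S.n) (by omega)
  · simpa [hp₀] using p_le.trans S.two_pow_size_le
  · exact natCast_abs_le (l := 1) (by omega)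
  · have : S.p = 2 := by
      simp [hp₀] at hp
      omega
    exact ⟨by simp [hm₀], by simp [hn₀], by simp [hp₀], by simp [this], by simp [hinit]⟩
  · exact natCast_abs_le (l := 0) (by omega)
  · have : S.p ≠ 2 := by
      simp [hp₀] at hp
      omega
    exact ⟨by simp [hm₀], by simp [hn₀], by simp [hp₀], by simp [this], by simp [hinit]⟩

/-- The invariant starts from the empty minor with `rDen = 1`. After the last row no equation is
left, so solvability is equivalent to `rOk = 1`. -/
theorem wp_algorithm (S : ValuedSystem) : algorithm.wp S.numBound S.expo
    (fun s => (S.Solvable ∧ s.reg rOk = 1) ∨ (¬ S.Solvable ∧ s.reg rOk = 0))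
    (init S.encode) := by
  have hm := S.m_le_expo
  have hn := S.n_succ_le_expo
  rw [algorithm]
  refine wp_prologue fun s hs => ⟨natCast_abs_le (l := 0) (by omega), ?_⟩
  have hr₁ : Ready S (s.setReg rI 0) := ⟨by simp [hs.m], by simp [hs.n], by simp [hs.p],
    by simp [hs.two], by simp [hs.input]⟩
  refine wp_forTo (a := 0) (b := S.m)
    (fun I t => ∀ i j, i < I → j ≤ S.n → S.matrix t i j = S.integral i j) (by decide) (by simp)
    (Nat.zero_le _) (by omega) (natCast_le_numBound (by omega))
    (fun t hF => (hr₁.of_frame hF).m) (by simp) ?_ ?_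
  · intro I t _ hIm htI hF htM
    refine wp_clearRow (hr₁.of_frame hF) htI hIm fun u _ hu i j hi hj => ?_
    rw [matrix_setReg, hu i j hj]
    by_cases h : i = I
    · rw [if_pos h, h]
    · rw [if_neg h, htM i j (by omega) hj]
  · intro t _ hF htM
    have ht := hr₁.of_frame hF
    refine ⟨natCast_abs_le (l := 1) (by omega), natCast_abs_le (l := 1) (by omega),
      natCast_abs_le (l := 0) (by omega), ?_⟩
    set s₁ := ((t.setReg rOk 1).setReg rDen 1).setReg rRow 0 with hs₁
    have hr₂ : Ready S s₁ := ⟨by simp [hs₁, ht.m], by simp [hs₁, ht.n], by simp [hs₁, ht.p],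
      by simp [hs₁, ht.two], by simp [hs₁, ht.input]⟩
    have hm₁ : S.matrix s₁ = S.matrix t := rfl
    change (forTo _ _ _).wp _ _ _ s₁
    refine wp_forTo (a := 0) (b := S.m) (Invariant S) (by decide) (by simp [hs₁]) (Nat.zero_le _)
      (by omega) (natCast_le_numBound (by omega)) (fun t hF => (hr₂.of_frame hF).m)
      ⟨.inr (by simp [hs₁]), ?_, ?_⟩ ?_ ?_
    · rw [hm₁]
      simpa [hs₁] using bareiss_zero htM
    · rw [hm₁, rowsSolvable_congr fun i j _ hi hj => htM i j hi hj, ← solvable_iff]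
      simp [hs₁]
    · intro k u _ hkm huk hFu hu
      refine wp_rowStep (hr₂.of_frame hFu) huk hkm hu fun v hv => ?_
      exact ⟨by simpa using hv.ok, by simpa using hv.bareiss, by simpa using hv.solvable⟩
    · intro u _ _ hu
      have h := hu.solvable
      rw [and_iff_left rowsSolvable_self] at h
      rcases hu.ok with hok | hok
      · exact .inr ⟨by rw [h, hok]; norm_num, hok⟩
      · exact .inl ⟨h.mpr hok, hok⟩

end ValuedSystem

/-! ### Polynomial-time decidability -/

theorem theorem4p7 :
    BitRAM.DecidableInPolyTime ValuedSystem.encode ValuedSystem.size ValuedSystem.Solvable := by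
  have hE : ∀ S : ValuedSystem, (3 * Polynomial.X ^ 2 + 4 : Polynomial ℕ).eval S.size = S.expo :=
    fun S => by simp [ValuedSystem.expo]
  refine decidableInPolyTime_of_wp ValuedSystem.algorithm (3 * Polynomial.X ^ 2 + 4)
    (fun S => ?_) (fun S z hz => ?_) fun S => ?_
  · rw [hE, ValuedSystem.expo]; omega
  · rw [hE]
    exact (ValuedSystem.abs_le_of_mem_encode hz).trans ValuedSystem.two_pow_size_le
  · rw [hE]
    exact ValuedSystem.wp_algorithm S
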